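/- Let $M_{11},M_{22},M_{13},M_{23},M_{33}\in\mathbb R$, let $$M=\begin{bmatrix} M_{11}&0&\tfrac12M_{13}\\0&M_{22}&\tfrac12M_{23}\\ \tfrac12M_{13}&\tfrac12M_{23}&M_{33}\end{bmatrix},\qquad S=\{x\in\mathbb R^3:\ x^TMx+x_3=0\},$$ a quadratic surface through the origin whose normal there is the $x_3$-axis. Put $\kappa_1=-2M_{11}$, $\kappa_2=-2M_{22}$, $\bar\kappa=(\kappa_1+\kappa_2)/2$, and let $e_1,e_2,e_3$ be the standard basis. The normal curvature of $S$ at the origin in the direction $(\cos\theta,\sin\theta,0)$, i.e. the signed curvature $y''(0)/(1+y'(0)^2)^{3/2}$ of the section $t\mapsto(t\cos\theta,t\sin\theta,y(t))$ of $S$ with $y(0)=0$, is $\kappa_1\cos^2\theta+\kappa_2\sin^2\theta$, so that $\kappa_1,\kappa_2$ are its extreme values. Let $x=x(s,t)$ be a local parametrization of $S$ around the origin: a one-to-one $C^1$ immersion of an open set $U\subset\mathbb R^2$ into $S$ that covers all points of $S$ close to $0$ (such parametrizations exist). For $r_s>0$ let $\mathcal N=\{(s,t)\in U:\|x(s,t)\|_2<r_s\}$,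 let $dS=\|\partial_sx\times\partial_tx\|_2\,ds\,dt$, and let $$P=P(0,\mathcal N)=\int_{\mathcal N}\frac{x\,x^T}{x^Tx}\,dS\Big/\int_{\mathcal N}dS .$$ All $O(\cdot)$ below refer to $r_s\to0^+$. Then $$P=L+O(r_s^4),\qquad L=\operatorname{diag}(\tfrac12,\tfrac12,0)+r_s^2\,(a_{ij}),$$ where $(a_{ij})$ is symmetric, $a_{12}=0$, and $$a_{11}=-\tfrac1{32}\big((M_{11}+M_{22})^2+4M_{11}^2\big),\quad a_{22}=-\tfrac1{32}\big((M_{11}+M_{22})^2+4M_{22}^2\big),$$ $$a_{13}=\tfrac1{16}M_{13}(3M_{11}+M_{22}),\quad a_{23}=\tfrac1{16}M_{23}(M_{11}+3M_{22}),\quad a_{33}=\tfrac1{16}(3M_{11}^2+2M_{11}M_{22}+3M_{22}^2).$$ Consequently, if $Q$ is either of the two matrices $P$ and $L$ (both depend on $r_s$), then for small $r_s$ the eigenvalues of $Q$, counted with multiplicity, can be labelled $\lambda_1,\lambda_2,\lambda_3$ so that: 1. $\lambda_i=\tfrac12-\tfrac1{32}(\bar\kappa^2+\kappa_i^2)r_s^2+O(r_s^4)$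 for $i=1,2$, and $\lambda_3=\tfrac1{32}(2\bar\kappa^2+\kappa_1^2+\kappa_2^2)r_s^2+O(r_s^4)$. 2. For $i=1,2$ the vector $u^i=e_i+2a_{i3}r_s^2e_3$ is an approximate eigenvector for $\lambda_i$: after normalization of $u^i$ in the two-norm, $\|(Q-\lambda_iI)u^i\|_2=O(r_s^4)$. 3. The exact dominant eigenvectors lie in the span of $u^1,u^2$ up to $O(r_s^4)$: there is a constant $C$ such that, for all small $r_s$, every $v$ with $Qv=\lambda_iv$, $i\in\{1,2\}$, satisfies $|v_3-2r_s^2(a_{13}v_1+a_{23}v_2)|\le Cr_s^4\|v\|_2$. 4. If $\kappa_1^2\ne\kappa_2^2$ and $\{i,j\}=\{1,2\}$, then $\lambda_i$ has, for small $r_s$, an exact eigenvector $w$ with $w_i=1$, $w_j=O(r_s^2)$ and $w_3=2a_{i3}r_s^2+O(r_s^4)$. -/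

import Mathlib

open Filter Topology MeasureTheory Asymptotics Set

/-- Euclidean three-space, with the two-norm. -/
abbrev E3 : Type := EuclideanSpace ℝ (Fin 3)

/-- The symmetric matrix `M` of the quadratic surface `0 = xᵀ M x + x₃`; the coefficients `M₁₃`, `M₂₃`
enter halved, and `M₁₂ = 0`. -/
noncomputable def quadricMatrix (M11 M22 M13 M23 M33 : ℝ) : Matrix (Fin 3) (Fin 3) ℝ :=
  !![M11, 0, M13 / 2;
     0, M22, M23 / 2;
     M13 / 2, M23 / 2, M33]

/-- The quadratic surface `{x : xᵀ M x + x₃ = 0}`. -/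
def quadricSurface (M : Matrix (Fin 3) (Fin 3) ℝ) : Set E3 :=
  {x | x.ofLp ⬝ᵥ M.mulVec x.ofLp + x 2 = 0}

/-- The surface-area density `‖∂X/∂s × ∂X/∂t‖₂` of a parametrization `X`, so that
`dS = areaDensity X (s, t) ds dt`. -/
noncomputable def areaDensity (X : ℝ × ℝ → E3) (p : ℝ × ℝ) : ℝ :=
  ‖(WithLp.toLp 2
      (crossProduct (fderiv ℝ X p (1, 0)).ofLp (fderiv ℝ X p (0, 1)).ofLp) : E3)‖

/-- `X`, restricted to the open set `U` of parameters, is a regular local parametrization around the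
point `v` of the set `S`: it is a one-to-one `C¹` immersion with values in `S` that covers all points
of `S` close to `v`. -/
structure IsLocalParametrization (S : Set E3) (v : E3) (U : Set (ℝ × ℝ)) (X : ℝ × ℝ → E3) :
    Prop where
  isOpen : IsOpen U
  contDiffOn : ContDiffOn ℝ 1 X U
  injOn : InjOn X U
  immersion : ∀ p ∈ U, areaDensity X p ≠ 0
  mapsTo : MapsTo X U S
  mem : v ∈ S
  covers : ∃ δ > 0, S ∩ Metric.ball v δ ⊆ X '' U

/-- The region `𝒩` of parameter space that maps into the search sphere of radius `r` around `v`. -/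
def searchRegion (U : Set (ℝ × ℝ)) (X : ℝ × ℝ → E3) (v : E3) (r : ℝ) : Set (ℝ × ℝ) :=
  {p ∈ U | ‖X p - v‖ < r}

/-- The continuous local direction covariance matrix
`P(v, 𝒩) = ∫_𝒩 (x - v)(x - v)ᵀ / ((x - v)ᵀ(x - v)) dS / ∫_𝒩 dS`. -/
noncomputable def localDirectionCovariance (U : Set (ℝ × ℝ)) (X : ℝ × ℝ → E3) (v : E3) (r : ℝ) :
    Matrix (Fin 3) (Fin 3) ℝ :=
  Matrix.of fun i j =>
    (∫ p in searchRegion U X v r,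
        (X p - v) i * (X p - v) j / ‖X p - v‖ ^ 2 * areaDensity X p) /
      ∫ p in searchRegion U X v r, areaDensity X p

/-- The coefficients `a_ij` of the second-order term. -/
noncomputable def covCoeff (M11 M22 M13 M23 : ℝ) : Matrix (Fin 3) (Fin 3) ℝ :=
  let a11 := -(1 / 32) * ((M11 + M22) ^ 2 + 4 * M11 ^ 2)
  let a22 := -(1 / 32) * ((M11 + M22) ^ 2 + 4 * M22 ^ 2)
  let a13 := 1 / 16 * M13 * (3 * M11 + M22)
  let a23 := 1 / 16 * M23 * (M11 + 3 * M22)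
  let a33 := 1 / 16 * (3 * M11 ^ 2 + 2 * M11 * M22 + 3 * M22 ^ 2)
  !![a11, 0, a13;
     0, a22, a23;
     a13, a23, a33]

/-- The leading-order matrix `diag(1/2, 1/2, 0) + r² (a_ij)`. -/
noncomputable def leadingCovariance (M11 M22 M13 M23 : ℝ) (r : ℝ) : Matrix (Fin 3) (Fin 3) ℝ :=
  Matrix.diagonal ![1 / 2, 1 / 2, 0] + r ^ 2 • covCoeff M11 M22 M13 M23

/-- The signed curvature at `t` of the plane curve `(t, y(t))`. -/
noncomputable def signedCurvature (y : ℝ → ℝ) (t : ℝ) : ℝ :=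
  deriv (deriv y) t / (1 + deriv y t ^ 2) ^ (3 / 2 : ℝ)

/-- Near the origin, the graph of `y` lies on the section of `S` by the plane that contains the
`x₃`-axis and the vector `(cos θ, sin θ, 0)`. -/
def IsNormalSection (S : Set E3) (θ : ℝ) (y : ℝ → ℝ) : Prop :=
  ContDiffAt ℝ 2 y 0 ∧ y 0 = 0 ∧
    ∀ᶠ t in 𝓝 (0 : ℝ), (!₂[t * Real.cos θ, t * Real.sin θ, y t] : E3) ∈ S

/-- `k` is the normal curvature at the origin of `S` (whose tangent plane there is `x₃ = 0`) in the
direction `(cos θ, sin θ, 0)`: the signed curvature of the normal section in that direction. -/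
def HasNormalCurvature (S : Set E3) (θ k : ℝ) : Prop :=
  (∃ y, IsNormalSection S θ y) ∧ ∀ y, IsNormalSection S θ y → signedCurvature y 0 = k

/-! In a small ball the surface is a graph z = z(x₁, x₂) over its tangent plane, and the planar
projection of any local parametrization is injective there. The change of variables formula
therefore turns both integrals in P into integrals over the projected region `disk r`, which no
longer depend on the parametrization (`setIntegral_searchRegion`).

Write q for the quadratic form M₁₁x₁² + M₂₂x₂² and l for the linear form M₁₃x₁ + M₂₃x₂. In planar
polar coordinates (ϱ, n) the slope z/ϱ satisfies a fixed-point equation, and iterating it expands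
the slope in powers of ϱ uniformly in n (`slope_approx_succ`). From this follow the expansions of
the integrands and of the boundary radius of the region, R = r - r³q²/2 + r⁴q²l + O(r⁵)
(`exists_disk_sandwich`). After radial integration the coefficients of r³ and r⁵ are odd in n and
cancel over the circle, so every integral is n₀r² + n₁r⁴ + O(r⁶) (`setIntegral_disk_expansion`).
Dividing by the area gives P = L + O(r⁴).

The spectral part uses only that Q is symmetric and Q = L + O(r⁴). A symmetric matrix has an
eigenvalue within ‖Qu - μu‖/‖u‖ of μ (`exists_eigenvalue_near`). Trial vectors for λ₁ and λ₃, which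
lie about 1/2 apart, locate two eigenvalues, and the trace gives the third; the case κ₁² = κ₂² needs
no separate treatment. Exact eigenvectors are controlled row by row: the third row of Qv = λv has
the gap 1/2, and row j has a gap of size |a_ii - a_jj|r². -/

/-! ### Spectrum of symmetric matrices close to diag(1/2, 1/2, 0) + r²a. -/

/-- Parseval in an orthonormal eigenbasis: the residual has coordinates (λ_k - μ)⟨b_k, u⟩, so its
norm is at least min |λ_k - μ| times ‖u‖. -/
theorem exists_eigenvalue_near {n : Type*} [Fintype n] [DecidableEq n] {Q : Matrix n n ℝ}
    (hQ : Q.IsHermitian) {u : EuclideanSpace ℝ n} (hu : u ≠ 0) (μ : ℝ) :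
    ∃ k, |hQ.eigenvalues k - μ| * ‖u‖ ≤ ‖Matrix.toEuclideanLin Q u - μ • u‖ := by
  by_contra! hcon
  set b := hQ.eigenvectorBasis
  have hinner : ∀ k, inner ℝ (b k) (Matrix.toEuclideanLin Q u - μ • u)
      = (hQ.eigenvalues k - μ) * inner ℝ (b k) u := by
    intro k
    have hb : Matrix.toEuclideanLin Q (b k) = hQ.eigenvalues k • b k := by
      have := hQ.mulVec_eigenvectorBasis k
      apply (WithLp.equiv 2 (n → ℝ)).injective
      simpa using! this
    have hs := (Matrix.isSymmetric_toEuclideanLin_iff.mpr hQ) (b k) u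
    rw [inner_sub_right, ← hs, hb, inner_smul_left, inner_smul_right]
    simp; ring
  have hne : Nonempty n := by
    by_contra h
    rw [not_nonempty_iff] at h
    exact hu (Subsingleton.elim _ _)
  have hsum : ∑ k, ‖inner ℝ (b k) (Matrix.toEuclideanLin Q u - μ • u)‖ ^ 2
      = ‖Matrix.toEuclideanLin Q u - μ • u‖ ^ 2 := b.sum_sq_norm_inner_right _
  have hsum' : ∑ k, ‖inner ℝ (b k) u‖ ^ 2 = ‖u‖ ^ 2 := b.sum_sq_norm_inner_right _
  set R := ‖Matrix.toEuclideanLin Q u - μ • u‖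
  have hupos : 0 < ‖u‖ := norm_pos_iff.mpr hu
  obtain ⟨k₀, -, hk₀⟩ := Finset.exists_min_image Finset.univ
    (fun k => |hQ.eigenvalues k - μ|) ⟨hne.some, Finset.mem_univ _⟩
  have h1 : |hQ.eigenvalues k₀ - μ| ^ 2 * ‖u‖ ^ 2 ≤ R ^ 2 := by
    rw [← hsum, ← hsum', Finset.mul_sum]
    refine Finset.sum_le_sum fun k _ => ?_
    rw [hinner, norm_mul, mul_pow, Real.norm_eq_abs, Real.norm_eq_abs]
    exact mul_le_mul_of_nonneg_right
      (pow_le_pow_left₀ (abs_nonneg _) (hk₀ k (Finset.mem_univ _)) 2) (by positivity)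
  have h2 := hcon k₀
  have h3 : 0 ≤ R := norm_nonneg _
  rw [← mul_pow] at h1
  exact absurd (abs_le_of_sq_le_sq' h1 (by positivity)).2 (by
    have := abs_le_of_sq_le_sq h1 h3
    rw [abs_of_nonneg (by positivity)] at this
    linarith)

theorem isBigO_euclidean {ι α : Type*} [Fintype ι] {l : Filter α} {v : α → EuclideanSpace ℝ ι}
    {g : α → ℝ} (h : ∀ i, (fun r => v r i) =O[l] g) : v =O[l] g := by
  have h1 : (fun r => (v r).ofLp) =O[l] g := isBigO_pi.mpr h
  exact (((EuclideanSpace.equiv ι ℝ).symm.toContinuousLinearMap).isBigO_comp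
    (fun r => (v r).ofLp) l).trans h1

/-- Once two eigenvalues are labelled 0 and 2, the remaining one gets the label 1. -/
theorem exists_perm_fin_three : ∀ i k : Fin 3, i ≠ k →
    ∃ σ : Equiv.Perm (Fin 3), σ 0 = i ∧ σ 2 = k := by decide

theorem isBigO_one_of_continuous {f : ℝ → ℝ} (hf : Continuous f) (x : ℝ) (s : Set ℝ) :
    f =O[𝓝[s] x] (fun _ => (1 : ℝ)) :=
  (hf.continuousAt.continuousWithinAt.tendsto).isBigO_one ℝ

theorem pow_mul_isBigO {f : ℝ → ℝ} (hf : Continuous f) (n : ℕ) (x : ℝ) (s : Set ℝ) :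
    (fun r => r ^ n * f r) =O[𝓝[s] x] (fun r => r ^ n) := by
  simpa using (isBigO_refl (fun r : ℝ => r ^ n) (𝓝[s] x)).mul (isBigO_one_of_continuous hf x s)

/-- The matrix `diag(1/2, 1/2, 0) + r² a`. -/
noncomputable def leadingMatrix (a : Matrix (Fin 3) (Fin 3) ℝ) (r : ℝ) :
    Matrix (Fin 3) (Fin 3) ℝ := Matrix.diagonal ![1 / 2, 1 / 2, 0] + r ^ 2 • a

theorem leadingMatrix_apply (a : Matrix (Fin 3) (Fin 3) ℝ) (r : ℝ) (i j : Fin 3) :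
    leadingMatrix a r i j = (if i = j then ![1 / 2, 1 / 2, 0] i else 0) + r ^ 2 * a i j := by
  simp [leadingMatrix, Matrix.diagonal_apply]

/-- The entries of `Q - leadingMatrix` are O(r⁴) and `u` is bounded near 0, so a residual estimate
for `Q` reduces to a polynomial identity for `leadingMatrix`, with explicit remainder r⁴c. -/
theorem residual_isBigO {a : Matrix (Fin 3) (Fin 3) ℝ} {Q : ℝ → Matrix (Fin 3) (Fin 3) ℝ}
    (hQ : ∀ i j, (fun r => Q r i j - leadingMatrix a r i j) =O[𝓝[>] 0] fun r => r ^ 4)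
    {u : ℝ → E3} (hu : ∀ i, Continuous fun r => u r i) {d : ℝ → ℝ}
    (c : ℝ → Fin 3 → ℝ) (hc : ∀ i, Continuous fun r => c r i)
    (h : ∀ r i, ∑ j, leadingMatrix a r i j * u r j - d r * u r i = r ^ 4 * c r i) :
    (fun r => Matrix.toEuclideanLin (Q r) (u r) - d r • u r) =O[𝓝[>] 0] fun r => r ^ 4 := by
  refine isBigO_euclidean fun i => ?_
  have h1 : (fun r => (Matrix.toEuclideanLin (Q r) (u r) - d r • u r) i)
      = fun r => ∑ j, (Q r i j - leadingMatrix a r i j) * u r j + r ^ 4 * c r i := by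
    funext r
    rw [← h r i]
    simp only [sub_mul, Finset.sum_sub_distrib]
    simp [Matrix.toLpLin_apply, Matrix.mulVec, dotProduct]
  rw [h1]
  refine IsBigO.add (IsBigO.fun_sum fun j _ => ?_) (pow_mul_isBigO (hc i) 4 0 _)
  simpa using (hQ i j).mul (isBigO_one_of_continuous (hu j) 0 (Ioi 0))

/-- The expansion of the eigenvalues. -/
noncomputable def leadingEigenvalue (a : Matrix (Fin 3) (Fin 3) ℝ) (i : Fin 3) (r : ℝ) : ℝ :=
  ![1 / 2, 1 / 2, 0] i + a i i * r ^ 2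

theorem eventually_pow_lt {c : ℝ} (hc : 0 < c) (C : ℝ) {n : ℕ} (hn : n ≠ 0) :
    ∀ᶠ r in 𝓝[>] (0 : ℝ), C * r ^ n < c := by
  have h : Tendsto (fun r : ℝ => C * r ^ n) (𝓝[>] 0) (𝓝 (C * 0 ^ n)) :=
    ((continuous_const.mul (continuous_id.pow n)).tendsto 0).mono_left nhdsWithin_le_nhds
  rw [zero_pow hn, mul_zero] at h
  exact h.eventually_lt_const hc

theorem exists_bound_isBigO {E : Type*} [Norm E] {f : ℝ → E} {n : ℕ}
    (h : f =O[𝓝[>] 0] fun r : ℝ => r ^ n) : ∃ C > 0, ∀ᶠ r in 𝓝[>] (0 : ℝ), ‖f r‖ ≤ C * r ^ n := by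
  obtain ⟨C, hC, h⟩ := h.exists_pos
  refine ⟨C, hC, ?_⟩
  filter_upwards [h.bound, self_mem_nhdsWithin] with r hr h0
  rwa [Real.norm_of_nonneg (pow_nonneg (le_of_lt h0) n)] at hr

/-- Residual bounds are used for the labels 0 and 2 only. Trial vectors for 0 and 1 might detect the
same eigenvalue when `a 0 0 = a 1 1`; the trace yields label 1 without this ambiguity. -/
theorem exists_eigenvalue_expansion {a : Matrix (Fin 3) (Fin 3) ℝ}
    {Q : ℝ → Matrix (Fin 3) (Fin 3) ℝ} (hsym : ∀ i j, a i j = a j i) (h01 : a 0 1 = 0)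
    (hQs : ∀ r, (Q r).IsHermitian)
    (hQ : ∀ i j, (fun r => Q r i j - leadingMatrix a r i j) =O[𝓝[>] 0] fun r => r ^ 4) :
    ∃ ev : Fin 3 → ℝ → ℝ,
      (∀ᶠ r in 𝓝[>] 0,
        (Q r).charpoly = ∏ i, (Polynomial.X - Polynomial.C (ev i r))) ∧
      ∀ i, (fun r => ev i r - leadingEigenvalue a i r) =O[𝓝[>] 0] fun r => r ^ 4 := by
  have h10 : a 1 0 = 0 := by rw [hsym, h01]
  have h20 := hsym 2 0
  have h21 := hsym 2 1
  -- First-order perturbation theory: the coupling a_i3 r² is divided by the gap 1/2 between the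
  -- unperturbed eigenvalues, whence the factor 2.
  let u0 : ℝ → E3 := fun r => !₂[1, 0, 2 * a 0 2 * r ^ 2]
  let u2 : ℝ → E3 := fun r => !₂[-2 * a 0 2 * r ^ 2, -2 * a 1 2 * r ^ 2, 1]
  have hR0 : (fun r => Matrix.toEuclideanLin (Q r) (u0 r) - leadingEigenvalue a 0 r • u0 r)
      =O[𝓝[>] 0] fun r => r ^ 4 := by
    refine residual_isBigO hQ ?_
      (fun r => ![2 * a 0 2 ^ 2, 2 * a 0 2 * a 1 2, 2 * a 0 2 * (a 2 2 - a 0 0)]) ?_ ?_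
    · intro i; fin_cases i <;> simp [u0] <;> fun_prop
    · intro i; fun_prop
    · intro r i
      fin_cases i <;>
        simp [Fin.sum_univ_three, leadingMatrix_apply, u0, leadingEigenvalue, h10, h20] <;> ring
  have hR2 : (fun r => Matrix.toEuclideanLin (Q r) (u2 r) - leadingEigenvalue a 2 r • u2 r)
      =O[𝓝[>] 0] fun r => r ^ 4 := by
    refine residual_isBigO hQ ?_
      (fun r => ![2 * a 0 2 * (a 2 2 - a 0 0), 2 * a 1 2 * (a 2 2 - a 1 1),
        -2 * a 0 2 ^ 2 - 2 * a 1 2 ^ 2]) ?_ ?_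
    · intro i; fin_cases i <;> simp [u2] <;> fun_prop
    · intro i; fun_prop
    · intro r i
      fin_cases i <;>
        simp [Fin.sum_univ_three, leadingMatrix_apply, u2, leadingEigenvalue, h10, h01, h20, h21]
          <;> ring
  have hT : (fun r => (Q r).trace - ∑ i, leadingEigenvalue a i r) =O[𝓝[>] 0] fun r => r ^ 4 := by
    have : (fun r => (Q r).trace - ∑ i, leadingEigenvalue a i r)
        = fun r => ∑ i, (Q r i i - leadingMatrix a r i i) := by
      funext r
      simp only [Matrix.trace, Matrix.diag, ← Finset.sum_sub_distrib, leadingMatrix_apply,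
        leadingEigenvalue]
      refine Finset.sum_congr rfl fun i _ => ?_
      simp; ring
    rw [this]
    exact IsBigO.fun_sum fun i _ => hQ i i
  obtain ⟨C0, hC0, h0⟩ := exists_bound_isBigO hR0
  obtain ⟨C2, hC2, h2⟩ := exists_bound_isBigO hR2
  obtain ⟨CT, hCT, h3⟩ := exists_bound_isBigO hT
  have hn0 : ∀ r, 1 ≤ ‖u0 r‖ := fun r => by
    have := PiLp.norm_apply_le (u0 r) 0
    simpa [u0] using this
  have hn2 : ∀ r, 1 ≤ ‖u2 r‖ := fun r => by
    have := PiLp.norm_apply_le (u2 r) 2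
    simpa [u2] using this
  have key : ∀ᶠ r in 𝓝[>] (0 : ℝ), ∃ σ : Equiv.Perm (Fin 3),
      ∀ i, |(hQs r).eigenvalues (σ i) - leadingEigenvalue a i r| ≤ (C0 + C2 + CT) * r ^ 4 := by
    filter_upwards [h0, h2, h3, eventually_pow_lt (c := 1 / 8) (by norm_num) (C0 + C2) (n := 4)
      (by norm_num), eventually_pow_lt (c := 1 / 8) (by norm_num) (|a 2 2 - a 0 0|) (n := 2)
      (by norm_num), self_mem_nhdsWithin] with r h0 h2 h3 hs hs2 hr
    obtain ⟨i, hi⟩ := exists_eigenvalue_near (hQs r) (u := u0 r)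
      (norm_pos_iff.mp (by linarith [hn0 r])) (leadingEigenvalue a 0 r)
    obtain ⟨k, hk⟩ := exists_eigenvalue_near (hQs r) (u := u2 r)
      (norm_pos_iff.mp (by linarith [hn2 r])) (leadingEigenvalue a 2 r)
    have hr4 : 0 ≤ r ^ 4 := by positivity
    have hi' : |(hQs r).eigenvalues i - leadingEigenvalue a 0 r| ≤ C0 * r ^ 4 :=
      (le_mul_of_one_le_right (abs_nonneg _) (hn0 r)).trans (hi.trans h0)
    have hk' : |(hQs r).eigenvalues k - leadingEigenvalue a 2 r| ≤ C2 * r ^ 4 :=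
      (le_mul_of_one_le_right (abs_nonneg _) (hn2 r)).trans (hk.trans h2)
    have hik : i ≠ k := by
      rintro rfl
      have hgap : leadingEigenvalue a 0 r - leadingEigenvalue a 2 r
          = 1 / 2 - (a 2 2 - a 0 0) * r ^ 2 := by
        simp [leadingEigenvalue]; ring
      have : (a 2 2 - a 0 0) * r ^ 2 ≤ |a 2 2 - a 0 0| * r ^ 2 := by
        gcongr; exact le_abs_self _
      rw [abs_le] at hi' hk'
      linarith [hi'.1, hi'.2, hk'.1, hk'.2]
    obtain ⟨σ, hσ0, hσ2⟩ := exists_perm_fin_three i k hik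
    have htr : (Q r).trace = ∑ i, (hQs r).eigenvalues (σ i) := by
      rw [Equiv.sum_comp σ (hQs r).eigenvalues]
      simpa using (hQs r).trace_eq_sum_eigenvalues
    rw [htr, Fin.sum_univ_three, Fin.sum_univ_three, hσ0, hσ2, Real.norm_eq_abs] at h3
    have p0 : 0 ≤ C0 * r ^ 4 := by positivity
    have p2 : 0 ≤ C2 * r ^ 4 := by positivity
    have pT : 0 ≤ CT * r ^ 4 := by positivity
    refine ⟨σ, fun j => ?_⟩
    rw [abs_le] at hi' hk' h3
    fin_cases j
    · simp only [Fin.zero_eta, hσ0, abs_le]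
      constructor <;> linarith [hi'.1, hi'.2]
    · simp only [Fin.mk_one, abs_le]
      constructor <;> linarith [hi'.1, hi'.2, hk'.1, hk'.2, h3.1, h3.2]
    · simp only [Fin.reduceFinMk, hσ2, abs_le]
      constructor <;> linarith [hk'.1, hk'.2]
  classical
  -- The value 0 is taken only where no admissible labelling exists, which does not happen for small
  -- r.
  let ev : Fin 3 → ℝ → ℝ := fun i r =>
    if h : ∃ σ : Equiv.Perm (Fin 3), ∀ i, |(hQs r).eigenvalues (σ i) - leadingEigenvalue a i r|
      ≤ (C0 + C2 + CT) * r ^ 4 then (hQs r).eigenvalues (h.choose i) else 0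
  refine ⟨ev, ?_, fun i => ?_⟩
  · filter_upwards [key] with r hr
    simp only [ev, dif_pos hr]
    rw [(hQs r).charpoly_eq]
    exact (Equiv.prod_comp hr.choose
      (fun i => Polynomial.X - Polynomial.C ((hQs r).eigenvalues i))).symm
  · refine IsBigO.of_bound (C0 + C2 + CT) ?_
    filter_upwards [key, self_mem_nhdsWithin] with r hr h0
    simp only [ev, dif_pos hr]
    rw [Real.norm_of_nonneg (pow_nonneg (le_of_lt h0) 4), Real.norm_eq_abs]
    exact hr.choose_spec i

theorem approx_eigenvector_isBigO {a : Matrix (Fin 3) (Fin 3) ℝ}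
    {Q : ℝ → Matrix (Fin 3) (Fin 3) ℝ} (hsym : ∀ i j, a i j = a j i) (h01 : a 0 1 = 0)
    (hQ : ∀ i j, (fun r => Q r i j - leadingMatrix a r i j) =O[𝓝[>] 0] fun r => r ^ 4)
    {ev : Fin 3 → ℝ → ℝ}
    (hev : ∀ i, (fun r => ev i r - leadingEigenvalue a i r) =O[𝓝[>] 0] fun r => r ^ 4)
    {i : Fin 3} (hi : i ≠ 2) {u : ℝ → E3}
    (hu : u = fun r => EuclideanSpace.single i 1 + (2 * a i 2 * r ^ 2) • EuclideanSpace.single 2 1) :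
    (fun r => ‖Matrix.toEuclideanLin (Q r) (‖u r‖⁻¹ • u r) - ev i r • (‖u r‖⁻¹ • u r)‖)
      =O[𝓝[>] 0] fun r => r ^ 4 := by
  have h10 : a 1 0 = 0 := by rw [hsym, h01]
  have h20 := hsym 2 0
  have h21 := hsym 2 1
  have hcont : ∀ j, Continuous fun r => u r j := by
    intro j; subst hu; simp only [PiLp.add_apply, PiLp.smul_apply]; fun_prop
  have hR : (fun r => Matrix.toEuclideanLin (Q r) (u r) - leadingEigenvalue a i r • u r)
      =O[𝓝[>] 0] fun r => r ^ 4 := by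
    refine residual_isBigO hQ hcont
      (fun r => ![2 * a 0 2 * a i 2, 2 * a 1 2 * a i 2, 2 * a i 2 * (a 2 2 - a i i)])
      (fun j => by fun_prop) ?_
    intro r j
    subst hu
    fin_cases i
    · fin_cases j <;> simp [Fin.sum_univ_three, leadingMatrix_apply, leadingEigenvalue, h10, h20]
        <;> ring
    · fin_cases j <;> simp [Fin.sum_univ_three, leadingMatrix_apply, leadingEigenvalue, h01, h21]
        <;> ring
    · exact absurd rfl hi
  have hu1 : u =O[𝓝[>] 0] fun _ => (1 : ℝ) :=
    isBigO_euclidean fun j => isBigO_one_of_continuous (hcont j) 0 _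
  have hR' : (fun r => Matrix.toEuclideanLin (Q r) (u r) - ev i r • u r)
      =O[𝓝[>] 0] fun r => r ^ 4 := by
    have h1 : (fun r => (ev i r - leadingEigenvalue a i r) • u r) =O[𝓝[>] 0] fun r => r ^ 4 := by
      simpa using (hev i).smul hu1
    refine (hR.sub h1).congr_left fun r => ?_
    rw [sub_smul]; abel
  have hn : ∀ r, 1 ≤ ‖u r‖ := fun r => by
    have := PiLp.norm_apply_le (u r) i
    subst hu
    simpa [hi] using this
  -- Since ‖u‖ ≥ 1, normalization can only shrink the residual.
  refine IsBigO.trans (IsBigO.of_bound 1 (Eventually.of_forall fun r => ?_)) hR'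
  rw [map_smul, smul_comm (ev i r), ← smul_sub, norm_norm, norm_smul, one_mul, norm_inv, norm_norm]
  exact mul_le_of_le_one_left (norm_nonneg _) (inv_le_one_of_one_le₀ (hn r))

theorem exists_uniform_bound {a : Matrix (Fin 3) (Fin 3) ℝ} {Q : ℝ → Matrix (Fin 3) (Fin 3) ℝ}
    (hQ : ∀ i j, (fun r => Q r i j - leadingMatrix a r i j) =O[𝓝[>] 0] fun r => r ^ 4)
    {ev : Fin 3 → ℝ → ℝ}
    (hev : ∀ i, (fun r => ev i r - leadingEigenvalue a i r) =O[𝓝[>] 0] fun r => r ^ 4) :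
    ∃ K > 0, (∀ i j, |a i j| ≤ K) ∧ ∀ᶠ r in 𝓝[>] (0 : ℝ),
      (∀ i j, |Q r i j - leadingMatrix a r i j| ≤ K * r ^ 4) ∧
      ∀ i, |ev i r - leadingEigenvalue a i r| ≤ K * r ^ 4 := by
  have h1 : (fun r => fun i j => Q r i j - leadingMatrix a r i j) =O[𝓝[>] 0] fun r => r ^ 4 :=
    isBigO_pi.mpr fun i => isBigO_pi.mpr fun j => hQ i j
  have h2 : (fun r => fun i => ev i r - leadingEigenvalue a i r) =O[𝓝[>] 0] fun r => r ^ 4 :=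
    isBigO_pi.mpr hev
  obtain ⟨C1, hC1, h1⟩ := exists_bound_isBigO h1
  obtain ⟨C2, hC2, h2⟩ := exists_bound_isBigO h2
  set B := ‖(fun i j => a i j : Fin 3 → Fin 3 → ℝ)‖
  have hB : 0 ≤ B := norm_nonneg _
  refine ⟨C1 + C2 + B, by positivity, fun i j => ?_, ?_⟩
  · have h3 := (norm_le_pi_norm (fun j => a i j) j).trans
      (norm_le_pi_norm (fun i j => a i j : Fin 3 → Fin 3 → ℝ) i)
    rw [Real.norm_eq_abs] at h3
    change |a i j| ≤ B at h3
    linarith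
  · filter_upwards [h1, h2, self_mem_nhdsWithin] with r h1 h2 hr
    have hr4 : 0 ≤ r ^ 4 := by positivity
    have p1 := mul_nonneg hC1.le hr4
    have p2 := mul_nonneg hC2.le hr4
    have p3 := mul_nonneg hB hr4
    refine ⟨fun i j => ?_, fun i => ?_⟩
    · have h3 := (norm_le_pi_norm (fun j => Q r i j - leadingMatrix a r i j) j).trans
        (norm_le_pi_norm (fun i j => Q r i j - leadingMatrix a r i j) i)
      rw [Real.norm_eq_abs] at h3
      linarith
    · have h3 := norm_le_pi_norm (fun i => ev i r - leadingEigenvalue a i r) i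
      rw [Real.norm_eq_abs] at h3
      linarith

theorem row_eq_of_eigenvector {Q : Matrix (Fin 3) (Fin 3) ℝ} {v : E3} {l : ℝ}
    (h : Matrix.toEuclideanLin Q v = l • v) (i : Fin 3) :
    Q i 0 * v 0 + Q i 1 * v 1 + Q i 2 * v 2 = l * v i := by
  have := congrArg (fun w : E3 => w i) h
  simpa [Matrix.toLpLin_apply, Matrix.mulVec, dotProduct, Fin.sum_univ_three] using this

theorem abs_mul_le_of_le {x y X Y : ℝ} (hx : |x| ≤ X) (hy : |y| ≤ Y) : |x * y| ≤ X * Y := by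
  rw [abs_mul]
  exact mul_le_mul hx hy (abs_nonneg _) ((abs_nonneg _).trans hx)

/-- The third component of a dominant eigenvector. -/
theorem dominant_eigenvector_third {a : Matrix (Fin 3) (Fin 3) ℝ}
    {Q : ℝ → Matrix (Fin 3) (Fin 3) ℝ} (hsym : ∀ i j, a i j = a j i)
    (hQ : ∀ i j, (fun r => Q r i j - leadingMatrix a r i j) =O[𝓝[>] 0] fun r => r ^ 4)
    {ev : Fin 3 → ℝ → ℝ}
    (hev : ∀ i, (fun r => ev i r - leadingEigenvalue a i r) =O[𝓝[>] 0] fun r => r ^ 4) :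
    ∃ C > 0, ∀ᶠ r in 𝓝[>] (0 : ℝ), ∀ i : Fin 3, i ≠ 2 → ∀ v : E3,
      Matrix.toEuclideanLin (Q r) v = ev i r • v →
        |v 2 - 2 * r ^ 2 * (a 0 2 * v 0 + a 1 2 * v 1)| ≤ C * r ^ 4 * ‖v‖ ∧
        |v 2| ≤ C * r ^ 2 * ‖v‖ := by
  obtain ⟨K, hK, ha, hb⟩ := exists_uniform_bound hQ hev
  refine ⟨4 * K + 128 * K ^ 2 + 16 * K, by positivity, ?_⟩
  filter_upwards [hb, self_mem_nhdsWithin, eventually_pow_lt one_pos 1 one_ne_zero,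
    eventually_pow_lt (c := 1 / 4) (by norm_num) (4 * K) two_ne_zero] with r hb hr h1 h2 i hi v hv
  obtain ⟨hE, hl⟩ := hb
  have hr : 0 < r := hr
  rw [one_mul, pow_one] at h1
  have hr42 : r ^ 4 ≤ r ^ 2 := pow_le_pow_of_le_one hr.le h1.le (by norm_num)
  have hrow := row_eq_of_eigenvector hv 2
  set N := ‖v‖
  have hN : ∀ j, |v j| ≤ N := fun j => by simpa using PiLp.norm_apply_le v j
  have hN0 : 0 ≤ N := norm_nonneg v
  have e0 := hE 2 0
  have e1 := hE 2 1
  have e2 := hE 2 2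
  simp [leadingMatrix_apply] at e0 e1 e2
  rw [hsym 2 0] at e0
  rw [hsym 2 1] at e1
  -- The third row reads (1/2 + δ)v₂ = Q₂₀v₀ + Q₂₁v₁, where δ = O(r²) measures how far the gap is
  -- from 1/2.
  set δ := ev i r - Q r 2 2 - 1 / 2 with hδ
  have hli := hl i
  have hδK : |δ| ≤ 4 * K * r ^ 2 := by
    have hd : leadingEigenvalue a i r = 1 / 2 + a i i * r ^ 2 := by
      fin_cases i
      · simp [leadingEigenvalue]
      · simp [leadingEigenvalue]
      · exact absurd rfl hi
    rw [hd] at hli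
    have q1 : |a i i * r ^ 2| ≤ K * r ^ 2 := abs_mul_le_of_le (ha i i) (abs_of_pos (by positivity)).le
    have q2 : |r ^ 2 * a 2 2| ≤ r ^ 2 * K := abs_mul_le_of_le (abs_of_pos (by positivity)).le (ha 2 2)
    have q3 : K * r ^ 4 ≤ K * r ^ 2 := by gcongr
    rw [abs_le] at *
    constructor <;> linarith [hli.1, hli.2, q1.1, q1.2, q2.1, q2.2, e2.1, e2.2]
  set E0 := Q r 2 0 - r ^ 2 * a 0 2 with hE0
  set E1 := Q r 2 1 - r ^ 2 * a 1 2 with hE1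
  have hmain : v 2 - 2 * r ^ 2 * (a 0 2 * v 0 + a 1 2 * v 1)
      = 2 * (E0 * v 0) + 2 * (E1 * v 1) - 2 * (δ * v 2) := by
    rw [hE0, hE1, hδ]; linear_combination (-2) * hrow
  have m0 := abs_mul_le_of_le e0 (hN 0)
  have m1 := abs_mul_le_of_le e1 (hN 1)
  have m2 := abs_mul_le_of_le hδK (le_refl |v 2|)
  have n0 := abs_mul_le_of_le (ha 0 2) (hN 0)
  have n1 := abs_mul_le_of_le (ha 1 2) (hN 1)
  have n01 : |r ^ 2 * (a 0 2 * v 0 + a 1 2 * v 1)| ≤ r ^ 2 * (2 * K * N) := by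
    refine abs_mul_le_of_le (abs_of_pos (by positivity)).le ?_
    rw [abs_le] at *
    constructor <;> linarith [n0.1, n0.2, n1.1, n1.2]
  -- A rough bound comes first: as 4Kr² < 1/4, the term 2|δv₂| is at most |v₂|/2 and is absorbed on
  -- the left. Inserting the bound O(r²) back into δv₂ then gives the error O(r⁴).
  have hv2 : |v 2| ≤ 16 * K * r ^ 2 * N := by
    have k1 : 4 * K * r ^ 2 * |v 2| ≤ 1 / 4 * |v 2| := by gcongr
    have k2 : K * r ^ 4 * N ≤ K * r ^ 2 * N := by gcongr
    have k3 : |v 2| ≤ 2 * (r ^ 2 * (2 * K * N)) + 2 * (K * r ^ 4 * N) + 2 * (K * r ^ 4 * N)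
        + 2 * (4 * K * r ^ 2 * |v 2|) := by
      rw [abs_le (a := v 2)]
      rw [abs_le] at m0 m1 m2 n01
      constructor <;> linarith [m0.1, m0.2, m1.1, m1.2, m2.1, m2.2, n01.1, n01.2]
    nlinarith
  refine ⟨?_, hv2.trans ?_⟩
  · have k3 : |v 2 - 2 * r ^ 2 * (a 0 2 * v 0 + a 1 2 * v 1)|
        ≤ 2 * (K * r ^ 4 * N) + 2 * (K * r ^ 4 * N) + 2 * (4 * K * r ^ 2 * |v 2|) := by
      rw [hmain]
      rw [abs_le] at *
      constructor <;> linarith [m0.1, m0.2, m1.1, m1.2, m2.1, m2.2]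
    have k4 : 4 * K * r ^ 2 * |v 2| ≤ 4 * K * r ^ 2 * (16 * K * r ^ 2 * N) := by gcongr
    have k5 : 0 ≤ K * r ^ 4 * N := by positivity
    calc _ ≤ _ := k3
      _ ≤ 4 * (K * r ^ 4 * N) + 2 * (4 * K * r ^ 2 * (16 * K * r ^ 2 * N)) := by linarith
      _ = (4 * K + 128 * K ^ 2) * r ^ 4 * N := by ring
      _ ≤ _ := by nlinarith
  · gcongr
    nlinarith [sq_nonneg K]

theorem eigenvector_of_charpoly {Q : Matrix (Fin 3) (Fin 3) ℝ} {ev : Fin 3 → ℝ}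
    (h : Q.charpoly = ∏ i, (Polynomial.X - Polynomial.C (ev i))) (i : Fin 3) :
    ∃ v : E3, v ≠ 0 ∧ Matrix.toEuclideanLin Q v = ev i • v := by
  have h0 : (Matrix.scalar (Fin 3) (ev i) - Q).det = 0 := by
    rw [← Matrix.eval_charpoly, h, Polynomial.eval_prod]
    exact Finset.prod_eq_zero (Finset.mem_univ i) (by simp)
  obtain ⟨v, hv, hv'⟩ := Matrix.exists_mulVec_eq_zero_iff.mpr h0
  refine ⟨WithLp.toLp 2 v, by simpa using hv, ?_⟩
  rw [Matrix.sub_mulVec, sub_eq_zero] at hv'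
  ext j
  have := congrFun hv' j
  simp [Matrix.toLpLin_apply, Matrix.scalar_apply, Matrix.mulVec_diagonal] at this ⊢
  exact this.symm

/-- Normalized dominant eigenvectors, when the two dominant eigenvalues separate. -/
theorem exists_normalized_eigenvector {a : Matrix (Fin 3) (Fin 3) ℝ}
    {Q : ℝ → Matrix (Fin 3) (Fin 3) ℝ} (hsym : ∀ i j, a i j = a j i) (h01 : a 0 1 = 0)
    (hQ : ∀ i j, (fun r => Q r i j - leadingMatrix a r i j) =O[𝓝[>] 0] fun r => r ^ 4)
    {ev : Fin 3 → ℝ → ℝ}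
    (hchar : ∀ᶠ r in 𝓝[>] 0,
        (Q r).charpoly = ∏ i, (Polynomial.X - Polynomial.C (ev i r)))
    (hev : ∀ i, (fun r => ev i r - leadingEigenvalue a i r) =O[𝓝[>] 0] fun r => r ^ 4)
    (hne : a 0 0 ≠ a 1 1) {i j : Fin 3} (hi : i ≠ 2) (hj : j ≠ 2) (hij : j ≠ i) :
    ∃ w : ℝ → E3,
      (∀ᶠ r in 𝓝[>] 0,
        Matrix.toEuclideanLin (Q r) (w r) = ev i r • w r ∧ w r i = 1) ∧
      ((fun r => w r j) =O[𝓝[>] 0] fun r => r ^ 2) ∧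
      ((fun r => w r 2 - 2 * a i 2 * r ^ 2) =O[𝓝[>] 0] fun r => r ^ 4) := by
  obtain ⟨K, hK, ha, hb⟩ := exists_uniform_bound hQ hev
  obtain ⟨C, hC, h3⟩ := dominant_eigenvector_third hsym hQ hev
  have hcases : (i = 0 ∧ j = 1) ∨ (i = 1 ∧ j = 0) := by
    revert i j; decide
  set g := |a i i - a j j| with hg
  have hgpos : 0 < g := by
    rw [hg, abs_pos, sub_ne_zero]
    rcases hcases with ⟨rfl, rfl⟩ | ⟨rfl, rfl⟩
    · exact hne
    · exact hne.symm
  -- Chosen so that (g/2)r² · Dr² equals Kr⁴ + 2Kr² · Cr², the bound for the right side of row j.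
  set D := 2 / g * (K + 2 * K * C) with hD
  have hDpos : 0 < D := by positivity
  have key : ∀ᶠ r in 𝓝[>] (0 : ℝ), ∃ w : E3, Matrix.toEuclideanLin (Q r) w = ev i r • w ∧
      w i = 1 ∧ |w j| ≤ 2 * D * r ^ 2 ∧ |w 2 - 2 * a i 2 * r ^ 2| ≤ (2 * C + 4 * K * D) * r ^ 4 := by
    filter_upwards [hb, h3, hchar, self_mem_nhdsWithin, eventually_pow_lt one_pos 1 one_ne_zero,
      eventually_pow_lt (c := g / 2) (by positivity) (2 * K) two_ne_zero,
      eventually_pow_lt (c := 1 / 2) (by norm_num) (D + C) two_ne_zero]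
      with r hb h3 hchar hr h1 h2 h4
    obtain ⟨hE, hl⟩ := hb
    have hr : 0 < r := hr
    rw [one_mul, pow_one] at h1
    have hr42 : r ^ 4 ≤ r ^ 2 := pow_le_pow_of_le_one hr.le h1.le (by norm_num)
    obtain ⟨v, hv0, hv⟩ := eigenvector_of_charpoly hchar i
    obtain ⟨-, hv2⟩ := h3 i hi v hv
    have hrow := row_eq_of_eigenvector hv j
    set N := ‖v‖ with hNdef
    have hNpos : 0 < N := norm_pos_iff.mpr hv0
    have hN : ∀ j, |v j| ≤ N := fun j => by simpa using PiLp.norm_apply_le v j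
    have hQji : |Q r j i| ≤ K * r ^ 4 := by
      have := hE j i
      rcases hcases with ⟨rfl, rfl⟩ | ⟨rfl, rfl⟩
      · simpa [leadingMatrix_apply, hsym 1 0, h01] using this
      · simpa [leadingMatrix_apply, h01] using this
    have hQj2 : |Q r j 2| ≤ 2 * K * r ^ 2 := by
      have := hE j 2
      rw [leadingMatrix_apply, if_neg hj, zero_add] at this
      have q2 : |r ^ 2 * a j 2| ≤ r ^ 2 * K :=
        abs_mul_le_of_le (abs_of_pos (by positivity)).le (ha j 2)
      have q3 : K * r ^ 4 ≤ K * r ^ 2 := by gcongr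
      rw [abs_le] at *
      constructor <;> linarith [this.1, this.2, q2.1, q2.2]
    -- Row j: the right side is O(r⁴) because `Q r j i` is O(r⁴) while `Q r j 2` and v₂ are both
    -- O(r²). The factor on the left is at least (g/2)r², so v_j = O(r²).
    have hrow' : (ev i r - Q r j j) * v j = Q r j i * v i + Q r j 2 * v 2 := by
      rcases hcases with ⟨rfl, rfl⟩ | ⟨rfl, rfl⟩ <;> linear_combination -hrow
    have hgap : g / 2 * r ^ 2 ≤ |ev i r - Q r j j| := by
      have q1 := hl i
      have q2 := hE j j
      have q3 : leadingEigenvalue a i r - leadingMatrix a r j j = (a i i - a j j) * r ^ 2 := by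
        rcases hcases with ⟨rfl, rfl⟩ | ⟨rfl, rfl⟩ <;>
          simp [leadingEigenvalue, leadingMatrix_apply] <;> ring
      have q4 : g * r ^ 2 = |(a i i - a j j) * r ^ 2| := by
        rw [abs_mul, abs_of_pos (by positivity : 0 < r ^ 2)]
      have q5 : |(a i i - a j j) * r ^ 2| ≤ |ev i r - Q r j j| + K * r ^ 4 + K * r ^ 4 := by
        rw [← q3]
        have : leadingEigenvalue a i r - leadingMatrix a r j j = (ev i r - Q r j j)
          - (ev i r - leadingEigenvalue a i r) + (Q r j j - leadingMatrix a r j j) := by ring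
        rw [this]
        refine (abs_add_le _ _).trans (add_le_add ((abs_sub _ _).trans ?_) q2)
        gcongr
      have q6 : K * r ^ 4 + K * r ^ 4 ≤ g / 2 * r ^ 2 := by
        have := mul_le_mul_of_nonneg_right h2.le (sq_nonneg r)
        linarith [this]
      linarith
    have hvj : |v j| ≤ D * r ^ 2 * N := by
      have q1 : |Q r j i * v i + Q r j 2 * v 2| ≤ K * r ^ 4 * N + 2 * K * r ^ 2 * (C * r ^ 2 * N) :=
        (abs_add_le _ _).trans
          (add_le_add (abs_mul_le_of_le hQji (hN i)) (abs_mul_le_of_le hQj2 hv2))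
      rw [← hrow', abs_mul] at q1
      have q2 : g / 2 * r ^ 2 * |v j| ≤ K * r ^ 4 * N + 2 * K * r ^ 2 * (C * r ^ 2 * N) :=
        (mul_le_mul_of_nonneg_right hgap (abs_nonneg _)).trans q1
      have q3 : g / 2 * r ^ 2 * (D * r ^ 2 * N)
          = K * r ^ 4 * N + 2 * K * r ^ 2 * (C * r ^ 2 * N) := by
        rw [hD]; field_simp
      rw [← q3] at q2
      exact le_of_mul_le_mul_left q2 (by positivity)
    -- The other two coordinates together are below N/2, so division by v_i is legitimate and leaves
    -- a vector of norm at most 2.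
    have hvi : N ≤ 2 * |v i| := by
      have q1 : N ≤ |v i| + |v j| + |v 2| := by
        refine abs_le_of_sq_le_sq (b := |v i| + |v j| + |v 2|) ?_ (by positivity) |>.trans' (le_abs_self N)
        have : N ^ 2 = |v i| ^ 2 + |v j| ^ 2 + |v 2| ^ 2 := by
          rw [hNdef, EuclideanSpace.norm_sq_eq, Fin.sum_univ_three]
          rcases hcases with ⟨rfl, rfl⟩ | ⟨rfl, rfl⟩ <;> simp <;> ring
        rw [this]
        nlinarith [mul_nonneg (abs_nonneg (v i)) (abs_nonneg (v j)),
          mul_nonneg (abs_nonneg (v i)) (abs_nonneg (v 2)),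
          mul_nonneg (abs_nonneg (v j)) (abs_nonneg (v 2))]
      have q2 := mul_le_mul_of_nonneg_right h4.le hNpos.le
      linarith
    have hvipos : 0 < |v i| := by linarith
    have hvi0 : v i ≠ 0 := abs_pos.mp hvipos
    have hw : Matrix.toEuclideanLin (Q r) ((v i)⁻¹ • v) = ev i r • ((v i)⁻¹ • v) := by
      rw [map_smul, hv, smul_comm]
    have hwn : ‖(v i)⁻¹ • v‖ ≤ 2 := by
      rw [norm_smul, norm_inv, Real.norm_eq_abs, inv_mul_le_iff₀ hvipos]
      linarith
    have hwj : |((v i)⁻¹ • v) j| ≤ 2 * D * r ^ 2 := by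
      rw [PiLp.smul_apply, smul_eq_mul, abs_mul, abs_inv, inv_mul_le_iff₀ hvipos]
      refine hvj.trans ?_
      have := mul_le_mul_of_nonneg_left hvi (by positivity : 0 ≤ D * r ^ 2)
      linarith
    have hwi : ((v i)⁻¹ • v) i = 1 := by
      rw [PiLp.smul_apply, smul_eq_mul, inv_mul_cancel₀ hvi0]
    refine ⟨(v i)⁻¹ • v, hw, hwi, hwj, ?_⟩
    obtain ⟨hw2, -⟩ := h3 i hi _ hw
    set w := (v i)⁻¹ • v
    have q1 : w 2 - 2 * a i 2 * r ^ 2 =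
        (w 2 - 2 * r ^ 2 * (a 0 2 * w 0 + a 1 2 * w 1)) + 2 * r ^ 2 * (a j 2 * w j) := by
      rcases hcases with ⟨rfl, rfl⟩ | ⟨rfl, rfl⟩ <;> rw [hwi] <;> ring
    rw [q1]
    have q2 := abs_mul_le_of_le (x := 2 * r ^ 2) (abs_of_pos (by positivity)).le
      (abs_mul_le_of_le (ha j 2) hwj)
    have q3 : C * r ^ 4 * ‖w‖ ≤ C * r ^ 4 * 2 := by gcongr
    calc _ ≤ _ := abs_add_le _ _
      _ ≤ C * r ^ 4 * 2 + 2 * r ^ 2 * (K * (2 * D * r ^ 2)) := add_le_add (hw2.trans q3) q2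
      _ = _ := by ring
  classical
  let w : ℝ → E3 := fun r => if h : ∃ w : E3, Matrix.toEuclideanLin (Q r) w = ev i r • w ∧
      w i = 1 ∧ |w j| ≤ 2 * D * r ^ 2 ∧ |w 2 - 2 * a i 2 * r ^ 2| ≤ (2 * C + 4 * K * D) * r ^ 4
    then h.choose else 0
  refine ⟨w, ?_, IsBigO.of_bound (2 * D) ?_, IsBigO.of_bound (2 * C + 4 * K * D) ?_⟩
  · filter_upwards [key] with r hr
    simp only [w, dif_pos hr]
    exact ⟨hr.choose_spec.1, hr.choose_spec.2.1⟩
  · filter_upwards [key] with r hr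
    simp only [w, dif_pos hr, Real.norm_eq_abs, abs_of_nonneg (sq_nonneg r)]
    exact hr.choose_spec.2.2.1
  · filter_upwards [key, self_mem_nhdsWithin] with r hr h0
    have h0 : 0 < r := h0
    simp only [w, dif_pos hr, Real.norm_eq_abs, abs_of_pos (pow_pos h0 4)]
    exact hr.choose_spec.2.2.2

/-! ### The quadric as a graph over its tangent plane, and its normal curvatures. -/

/-- The coefficients of a quadric `m₁₁x² + m₂₂y² + m₁₃xz + m₂₃yz + m₃₃z² + z = 0`. -/
structure QuadricCoeffs where
  m11 : ℝ
  m22 : ℝ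
  m13 : ℝ
  m23 : ℝ
  m33 : ℝ

namespace QuadricCoeffs

variable (m : QuadricCoeffs)

/-- The quadratic surface. -/
def surface : Set E3 := quadricSurface (quadricMatrix m.m11 m.m22 m.m13 m.m23 m.m33)

/-- The quadratic form in the tangent plane. -/
def q (x : ℝ × ℝ) : ℝ := m.m11 * x.1 ^ 2 + m.m22 * x.2 ^ 2

/-- The linear form that multiplies the third coordinate. -/
def l (x : ℝ × ℝ) : ℝ := m.m13 * x.1 + m.m23 * x.2

theorem mem_surface {v : E3} :
    v ∈ m.surface ↔ m.q (v 0, v 1) + (1 + m.l (v 0, v 1)) * v 2 + m.m33 * v 2 ^ 2 = 0 := by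
  simp only [surface, quadricSurface, mem_ofPred_eq, quadricMatrix, dotProduct, Matrix.mulVec,
    Fin.sum_univ_three, q, l]
  simp
  constructor <;> intro h <;> linear_combination h

/-- The discriminant of the equation of the surface, as an equation for the third coordinate. -/
def disc (x : ℝ × ℝ) : ℝ := (1 + m.l x) ^ 2 - 4 * m.m33 * m.q x

/-- The surface as a graph, near the origin. -/
noncomputable def graph (x : ℝ × ℝ) : ℝ := -2 * m.q x / (1 + m.l x + √(m.disc x))

/-- A bound for all coefficients. -/
def bound : ℝ := 1 + |m.m11| + |m.m22| + |m.m13| + |m.m23| + |m.m33|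

/-- A radius within which the surface is a graph. -/
noncomputable def rad : ℝ := 1 / (16 * m.bound ^ 2)

theorem one_le_bound : 1 ≤ m.bound := by
  unfold bound
  have := abs_nonneg m.m11; have := abs_nonneg m.m22; have := abs_nonneg m.m13
  have := abs_nonneg m.m23; have := abs_nonneg m.m33
  linarith

theorem rad_pos : 0 < m.rad := by
  have := m.one_le_bound
  unfold rad; positivity

theorem bound_sq_mul_rad : m.bound ^ 2 * m.rad = 1 / 16 := by
  have := m.one_le_bound
  unfold rad; field_simp

theorem bound_mul_rad_le : m.bound * m.rad ≤ 1 / 16 := by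
  rw [← bound_sq_mul_rad]
  have := m.one_le_bound
  have := m.rad_pos
  gcongr
  nlinarith

theorem rad_le : m.rad ≤ 1 / 16 := by
  have := m.one_le_bound
  have := m.rad_pos
  nlinarith [m.bound_mul_rad_le]

theorem abs_m33_le : |m.m33| ≤ m.bound := by
  unfold bound
  have := abs_nonneg m.m11; have := abs_nonneg m.m22; have := abs_nonneg m.m13
  have := abs_nonneg m.m23
  linarith

variable {m}

theorem abs_l_le {x : ℝ × ℝ} {d : ℝ} (h1 : |x.1| ≤ d) (h2 : |x.2| ≤ d) :
    |m.l x| ≤ m.bound * d := by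
  have hd : 0 ≤ d := (abs_nonneg _).trans h1
  have k1 := abs_mul_le_of_le (le_refl |m.m13|) h1
  have k2 := abs_mul_le_of_le (le_refl |m.m23|) h2
  have : |m.l x| ≤ |m.m13| * d + |m.m23| * d := (abs_add_le _ _).trans (add_le_add k1 k2)
  refine this.trans ?_
  rw [← add_mul]
  gcongr
  unfold bound
  have := abs_nonneg m.m11; have := abs_nonneg m.m22; have := abs_nonneg m.m33
  linarith

theorem abs_q_le {x : ℝ × ℝ} {d : ℝ} (h1 : |x.1| ≤ d) (h2 : |x.2| ≤ d) :
    |m.q x| ≤ m.bound * d ^ 2 := by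
  have hd : 0 ≤ d := (abs_nonneg _).trans h1
  have k1 := abs_mul_le_of_le (le_refl |m.m11|) (x := m.m11) (y := x.1 ^ 2) (Y := d ^ 2)
    (by rw [abs_pow]; gcongr)
  have k2 := abs_mul_le_of_le (le_refl |m.m22|) (x := m.m22) (y := x.2 ^ 2) (Y := d ^ 2)
    (by rw [abs_pow]; gcongr)
  have : |m.q x| ≤ |m.m11| * d ^ 2 + |m.m22| * d ^ 2 := (abs_add_le _ _).trans (add_le_add k1 k2)
  refine this.trans ?_
  rw [← add_mul]
  gcongr
  unfold bound
  have := abs_nonneg m.m13; have := abs_nonneg m.m23; have := abs_nonneg m.m33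
  linarith

theorem abs_l_le_of_lt_rad {x : ℝ × ℝ} (h1 : |x.1| < m.rad) (h2 : |x.2| < m.rad) :
    |m.l x| ≤ 1 / 16 :=
  (abs_l_le h1.le h2.le).trans m.bound_mul_rad_le

theorem disc_ge {x : ℝ × ℝ} (h1 : |x.1| < m.rad) (h2 : |x.2| < m.rad) : 1 / 4 ≤ m.disc x := by
  have hl := abs_l_le_of_lt_rad h1 h2
  have hq := abs_mul_le_of_le m.abs_m33_le (abs_q_le (m := m) h1.le h2.le)
  have : m.bound * (m.bound * m.rad ^ 2) ≤ 1 / 16 * (1 / 16) := by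
    calc _ = m.bound ^ 2 * m.rad * m.rad := by ring
      _ ≤ _ := by rw [bound_sq_mul_rad]; gcongr; exact m.rad_le
  unfold disc
  rw [abs_le] at hl hq
  nlinarith [hl.1, hl.2, hq.1, hq.2]

theorem one_le_denom {x : ℝ × ℝ} (h1 : |x.1| < m.rad) (h2 : |x.2| < m.rad) :
    1 ≤ 1 + m.l x + √(m.disc x) := by
  have hl := abs_l_le_of_lt_rad h1 h2
  have : 1 / 2 ≤ √(m.disc x) := Real.le_sqrt_of_sq_le (by linarith [disc_ge h1 h2])
  rw [abs_le] at hl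
  linarith [hl.1]

theorem abs_graph_le {x : ℝ × ℝ} (h1 : |x.1| < m.rad) (h2 : |x.2| < m.rad) :
    |m.graph x| ≤ 2 * |m.q x| := by
  have hd := one_le_denom h1 h2
  rw [graph, abs_div, abs_of_pos (by linarith : 0 < 1 + m.l x + √(m.disc x)), abs_mul]
  rw [div_le_iff₀ (by linarith)]
  simp only [abs_neg, Nat.abs_ofNat]
  exact le_mul_of_one_le_right (by positivity) hd

/-- The rationalized quadratic formula selects the root that vanishes at the origin and remains
meaningful when `m33 = 0`. -/
theorem graph_eq {x : ℝ × ℝ} (h1 : |x.1| < m.rad) (h2 : |x.2| < m.rad) :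
    m.q x + (1 + m.l x) * m.graph x + m.m33 * m.graph x ^ 2 = 0 := by
  have hd := one_le_denom h1 h2
  have hs : √(m.disc x) ^ 2 = (1 + m.l x) ^ 2 - 4 * m.m33 * m.q x :=
    Real.sq_sqrt (by linarith [disc_ge h1 h2])
  unfold graph
  have hne : 1 + m.l x + √(m.disc x) ≠ 0 := by linarith
  field_simp
  linear_combination (m.q x) * hs

/-- For small z the derivative 1 + l + 2m₃₃z of the equation in z is positive, and its square is the
discriminant; hence it is the positive square root, which fixes the branch. -/
theorem eq_graph {x : ℝ × ℝ} {z : ℝ} (h1 : |x.1| < m.rad) (h2 : |x.2| < m.rad)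
    (h3 : |z| < m.rad) (h : m.q x + (1 + m.l x) * z + m.m33 * z ^ 2 = 0) : z = m.graph x := by
  have hl := abs_l_le_of_lt_rad h1 h2
  have hz : |m.m33 * z| ≤ 1 / 16 :=
    (abs_mul_le_of_le m.abs_m33_le h3.le).trans m.bound_mul_rad_le
  rw [abs_le] at hl hz
  have hpos : 0 ≤ 1 + m.l x + 2 * m.m33 * z := by linarith [hl.1, hz.1]
  have hsq : (1 + m.l x + 2 * m.m33 * z) ^ 2 = m.disc x := by
    unfold disc; linear_combination 4 * m.m33 * h
  have hd := one_le_denom h1 h2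
  unfold graph
  rw [eq_div_iff (by linarith), ← hsq, Real.sqrt_sq hpos]
  linear_combination 2 * h

theorem contDiffAt_graph {n : WithTop ℕ∞} {x : ℝ × ℝ} (h1 : |x.1| < m.rad) (h2 : |x.2| < m.rad) :
    ContDiffAt ℝ n m.graph x := by
  have hd := one_le_denom h1 h2
  have hq : ContDiffAt ℝ n m.q x := by unfold q; fun_prop
  have hl : ContDiffAt ℝ n m.l x := by unfold l; fun_prop
  have hdisc : ContDiffAt ℝ n m.disc x := by unfold disc; fun_prop
  unfold graph
  exact (contDiffAt_const.mul hq).div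
    ((contDiffAt_const.add hl).add (hdisc.sqrt (by linarith [disc_ge h1 h2]))) (by linarith)

theorem toLp_graph_mem {x : ℝ × ℝ} (h1 : |x.1| < m.rad) (h2 : |x.2| < m.rad) :
    (!₂[x.1, x.2, m.graph x] : E3) ∈ m.surface := by
  rw [mem_surface]
  simpa using graph_eq h1 h2

theorem coord_lt {v : E3} {d : ℝ} (hv : ‖v‖ < d) (i : Fin 3) : |v i| < d :=
  lt_of_le_of_lt (by simpa using PiLp.norm_apply_le v i) hv

theorem eq_graph_of_mem {v : E3} (hv : v ∈ m.surface) (hr : ‖v‖ < m.rad) :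
    v 2 = m.graph (v 0, v 1) :=
  eq_graph (coord_lt hr 0) (coord_lt hr 1) (coord_lt hr 2) (m.mem_surface.mp hv)

/-! ### Normal curvatures -/

theorem isNormalSection_graph (θ : ℝ) :
    IsNormalSection m.surface θ fun t => m.graph (t * Real.cos θ, t * Real.sin θ) := by
  have h0 : (fun t : ℝ => (t * Real.cos θ, t * Real.sin θ)) 0 = 0 := by simp
  have hr := m.rad_pos
  refine ⟨?_, by simp [graph, q], ?_⟩
  · refine ContDiffAt.comp (0 : ℝ) (g := m.graph) (f := fun t => (t * Real.cos θ, t * Real.sin θ))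
      (contDiffAt_graph ?_ ?_) (by fun_prop) <;> simpa using hr
  · have hc : ContinuousAt (fun t : ℝ => |t * Real.cos θ|) 0 := by fun_prop
    have hs : ContinuousAt (fun t : ℝ => |t * Real.sin θ|) 0 := by fun_prop
    filter_upwards [hc.eventually_lt_const (u := m.rad) (by simpa using hr),
      hs.eventually_lt_const (u := m.rad) (by simpa using hr)] with t h1 h2
    exact toLp_graph_mem (x := (t * Real.cos θ, t * Real.sin θ)) h1 h2

/-- Implicit differentiation at 0: one derivative gives y'(0) = 0, two give y''(0) = -2Q. Only the
equation of the surface enters, so all C² sections agree. -/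
theorem signedCurvature_of_isNormalSection {θ : ℝ} {y : ℝ → ℝ}
    (hy : IsNormalSection m.surface θ y) :
    signedCurvature y 0 = -2 * m.q (Real.cos θ, Real.sin θ) := by
  obtain ⟨hC, h0, hS⟩ := hy
  set Q := m.q (Real.cos θ, Real.sin θ) with hQ
  set k := m.l (Real.cos θ, Real.sin θ) with hk
  have hF : ∀ᶠ t in 𝓝 (0 : ℝ), Q * t ^ 2 + (1 + k * t) * y t + m.m33 * y t ^ 2 = 0 := by
    filter_upwards [hS] with t ht
    have := m.mem_surface.mp ht
    simp [q, l] at this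
    rw [hQ, hk, q, l]
    linear_combination this
  have hd : ∀ᶠ t in 𝓝 (0 : ℝ), DifferentiableAt ℝ y t := by
    filter_upwards [hC.eventually (by simp)] with t ht
    exact ht.differentiableAt (by simp)
  have hd2 : HasDerivAt (deriv y) (deriv (deriv y) 0) 0 := by
    have h1 : ContDiffAt ℝ 1 (fderiv ℝ y) 0 := hC.fderiv_right (by norm_num)
    have h2 : DifferentiableAt ℝ (fun t => fderiv ℝ y t 1) 0 :=
      (h1.differentiableAt (by simp)).clm_apply (differentiableAt_const _)
    have h3 : (fun t => fderiv ℝ y t 1) = deriv y := by funext t; simp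
    rw [h3] at h2
    exact h2.hasDerivAt
  have hF1 : ∀ᶠ t in 𝓝 (0 : ℝ), 2 * Q * t + k * y t + (1 + k * t) * deriv y t
      + 2 * m.m33 * (y t * deriv y t) = 0 := by
    filter_upwards [hF.eventually_nhds, hd] with t ht hdt
    have h1 : HasDerivAt (fun t => Q * t ^ 2 + (1 + k * t) * y t + m.m33 * y t ^ 2) 0 t :=
      (hasDerivAt_const t (0 : ℝ)).congr_of_eventuallyEq ht
    have h2 := (((hasDerivAt_pow 2 t).const_mul Q).add
      ((((hasDerivAt_id t).const_mul k).const_add 1).mul hdt.hasDerivAt)).add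
      ((hdt.hasDerivAt.pow 2).const_mul m.m33)
    have := h2.unique h1
    simp at this
    linear_combination this
  have hy1 : deriv y 0 = 0 := by
    have := hF1.self_of_nhds
    simpa [h0] using this
  have hy2 : deriv (deriv y) 0 = -2 * Q := by
    have h1 : HasDerivAt (fun t => 2 * Q * t + k * y t + (1 + k * t) * deriv y t
      + 2 * m.m33 * (y t * deriv y t)) 0 0 :=
      (hasDerivAt_const (0 : ℝ) (0 : ℝ)).congr_of_eventuallyEq hF1
    have hdt := hd.self_of_nhds.hasDerivAt
    have h2 := ((((hasDerivAt_id (0 : ℝ)).const_mul (2 * Q)).add (hdt.const_mul k)).add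
      ((((hasDerivAt_id (0 : ℝ)).const_mul k).const_add 1).mul hd2)).add
      ((hdt.mul hd2).const_mul (2 * m.m33))
    have := h2.unique h1
    simp [h0, hy1] at this
    linarith
  simp [signedCurvature, hy1, hy2]

theorem hasNormalCurvature_iff {θ k : ℝ} :
    HasNormalCurvature m.surface θ k ↔ k = -2 * m.q (Real.cos θ, Real.sin θ) := by
  constructor
  · rintro ⟨⟨y, hy⟩, h⟩
    rw [← h y hy, signedCurvature_of_isNormalSection hy]
  · rintro rfl
    exact ⟨⟨_, isNormalSection_graph θ⟩, fun y hy => signedCurvature_of_isNormalSection hy⟩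

/-! ### The graph parametrization -/

theorem fderiv_euclidean_apply {E ι : Type*} [NormedAddCommGroup E] [NormedSpace ℝ E] [Fintype ι]
    {X : E → EuclideanSpace ℝ ι} {p : E} (h : DifferentiableAt ℝ X p) (i : ι) :
    HasFDerivAt (fun p => X p i) ((EuclideanSpace.proj i : EuclideanSpace ℝ ι →L[ℝ] ℝ).comp
      (fderiv ℝ X p)) p :=
  (EuclideanSpace.proj i : EuclideanSpace ℝ ι →L[ℝ] ℝ).hasFDerivAt.comp p h.hasFDerivAt

theorem areaDensity_eq (X : ℝ × ℝ → E3) (p : ℝ × ℝ) :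
    areaDensity X p =
      let s := fderiv ℝ X p (1, 0)
      let t := fderiv ℝ X p (0, 1)
      √((s 1 * t 2 - s 2 * t 1) ^ 2 + (s 2 * t 0 - s 0 * t 2) ^ 2
        + (s 0 * t 1 - s 1 * t 0) ^ 2) := by
  simp only [areaDensity, cross_apply, EuclideanSpace.norm_eq, Fin.sum_univ_three]
  simp

theorem isLocalParametrization_graph :
    IsLocalParametrization m.surface 0 (Metric.ball 0 m.rad)
      fun p => (!₂[p.1, p.2, m.graph p] : E3) := by
  have hball : ∀ p ∈ Metric.ball (0 : ℝ × ℝ) m.rad, |p.1| < m.rad ∧ |p.2| < m.rad := by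
    intro p hp
    rw [mem_ball_zero_iff, Prod.norm_def, max_lt_iff] at hp
    simpa using hp
  have hX : ∀ p ∈ Metric.ball (0 : ℝ × ℝ) m.rad,
      ContDiffAt ℝ 1 (fun p => (!₂[p.1, p.2, m.graph p] : E3)) p := by
    intro p hp
    obtain ⟨h1, h2⟩ := hball p hp
    have hg := contDiffAt_graph (n := 1) h1 h2
    rw [contDiffAt_euclidean]
    intro i
    fin_cases i
    · simpa using contDiffAt_fst
    · simpa using contDiffAt_snd
    · simpa using hg
  refine ⟨Metric.isOpen_ball, fun p hp => (hX p hp).contDiffWithinAt, ?_, ?_, ?_, ?_, ?_⟩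
  · intro p _ p' _ h
    have h0 := congrArg (fun v : E3 => v 0) h
    have h1 := congrArg (fun v : E3 => v 1) h
    simp at h0 h1
    exact Prod.ext h0 h1
  · intro p hp
    have hd := (hX p hp).differentiableAt (by simp)
    have e0 := (fderiv_euclidean_apply hd 0).unique
      (f₁' := ContinuousLinearMap.fst ℝ ℝ ℝ) (by simpa using hasFDerivAt_fst)
    have e1 := (fderiv_euclidean_apply hd 1).unique
      (f₁' := ContinuousLinearMap.snd ℝ ℝ ℝ) (by simpa using hasFDerivAt_snd)
    set X : ℝ × ℝ → E3 := fun p => !₂[p.1, p.2, m.graph p]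
    have a0 : fderiv ℝ X p (1, 0) 0 = 1 := congrArg (fun T : ℝ × ℝ →L[ℝ] ℝ => T (1, 0)) e0
    have a1 : fderiv ℝ X p (0, 1) 0 = 0 := congrArg (fun T : ℝ × ℝ →L[ℝ] ℝ => T (0, 1)) e0
    have b0 : fderiv ℝ X p (1, 0) 1 = 0 := congrArg (fun T : ℝ × ℝ →L[ℝ] ℝ => T (1, 0)) e1
    have b1 : fderiv ℝ X p (0, 1) 1 = 1 := congrArg (fun T : ℝ × ℝ →L[ℝ] ℝ => T (0, 1)) e1
    rw [areaDensity_eq]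
    simp only [a0, a1, b0, b1]
    -- The third component of the cross product of the two tangent vectors is 1.
    refine (Real.sqrt_pos.mpr (add_pos_of_nonneg_of_pos (by positivity) (by norm_num))).ne'
  · intro p hp
    obtain ⟨h1, h2⟩ := hball p hp
    exact toLp_graph_mem h1 h2
  · rw [mem_surface]; simp [q]
  · refine ⟨m.rad, m.rad_pos, fun v hv => ?_⟩
    have hn : ‖v‖ < m.rad := by simpa using hv.2
    refine ⟨(v 0, v 1), ?_, ?_⟩
    · rw [mem_ball_zero_iff, Prod.norm_def, max_lt_iff]
      exact ⟨by simpa using coord_lt hn 0, by simpa using coord_lt hn 1⟩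
    · ext i
      fin_cases i
      · rfl
      · rfl
      · exact (eq_graph_of_mem hv.1 hn).symm

end QuadricCoeffs

/-! ### Reduction of surface integrals to the tangent plane. -/

theorem ContinuousLinearMap.det_prod_real (T : ℝ × ℝ →L[ℝ] ℝ × ℝ) :
    T.det = (T (1, 0)).1 * (T (0, 1)).2 - (T (0, 1)).1 * (T (1, 0)).2 := by
  change LinearMap.det (T : ℝ × ℝ →ₗ[ℝ] ℝ × ℝ) = _
  rw [← LinearMap.det_toMatrix (Module.Basis.finTwoProd ℝ), Matrix.det_fin_two]
  simp [LinearMap.toMatrix_apply]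

namespace QuadricCoeffs

variable (m : QuadricCoeffs)

/-- The area density of the surface with respect to its tangent plane at the origin. -/
noncomputable def density (x : ℝ × ℝ) (z : ℝ) : ℝ :=
  √(1 + ((2 * m.m11 * x.1 + m.m13 * z) ^ 2 + (2 * m.m22 * x.2 + m.m23 * z) ^ 2)
    / (1 + m.l x + 2 * m.m33 * z) ^ 2)

/-- The projection to the tangent plane of the part of the surface inside the search sphere. -/
def disk (r : ℝ) : Set (ℝ × ℝ) := {x | x.1 ^ 2 + x.2 ^ 2 + m.graph x ^ 2 < r ^ 2}

variable {m}

/-- Differentiating the equation along the surface shows both tangent vectors orthogonal to the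
gradient (a, b, c). Their cross product has third component det T, so it equals det T · (a/c, b/c,
1). -/
theorem areaDensity_eq_density {X : ℝ × ℝ → E3} {p : ℝ × ℝ} (hX : DifferentiableAt ℝ X p)
    (hS : ∀ᶠ p' in 𝓝 p, X p' ∈ m.surface)
    (hz : 1 + m.l (X p 0, X p 1) + 2 * m.m33 * X p 2 ≠ 0) {T : ℝ × ℝ →L[ℝ] ℝ × ℝ}
    (hT : HasFDerivAt (fun p => (X p 0, X p 1)) T p) :
    areaDensity X p = |T.det| * m.density (X p 0, X p 1) (X p 2) := by
  have h0 := fderiv_euclidean_apply hX 0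
  have h1 := fderiv_euclidean_apply hX 1
  have h2 := fderiv_euclidean_apply hX 2
  have hTeq := hT.unique (h0.prodMk h1)
  have hF0 : HasFDerivAt (fun p => m.m11 * (X p 0 * X p 0) + m.m22 * (X p 1 * X p 1)
      + (1 + (m.m13 * X p 0 + m.m23 * X p 1)) * X p 2 + m.m33 * (X p 2 * X p 2))
      (0 : ℝ × ℝ →L[ℝ] ℝ) p := by
    refine (hasFDerivAt_const (0 : ℝ) p).congr_of_eventuallyEq ?_
    filter_upwards [hS] with p' hp'
    have := m.mem_surface.mp hp'
    simp only [q, l] at this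
    linear_combination this
  have hF1 := ((((h0.mul h0).const_mul m.m11).add ((h1.mul h1).const_mul m.m22)).add
    ((((h0.const_mul m.m13).add (h1.const_mul m.m23)).const_add 1).mul h2)).add
    ((h2.mul h2).const_mul m.m33)
  have hF := hF1.unique hF0
  set z := X p 2
  set x := X p 0
  set y := X p 1
  set s := fderiv ℝ X p (1, 0)
  set t := fderiv ℝ X p (0, 1)
  have hs : (2 * m.m11 * x + m.m13 * z) * s 0 + (2 * m.m22 * y + m.m23 * z) * s 1
      + (1 + m.l (x, y) + 2 * m.m33 * z) * s 2 = 0 := by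
    have : _ = (0 : ℝ) := congrArg (fun T : ℝ × ℝ →L[ℝ] ℝ => T (1, 0)) hF
    simp at this
    simp only [l]
    linear_combination this
  have ht : (2 * m.m11 * x + m.m13 * z) * t 0 + (2 * m.m22 * y + m.m23 * z) * t 1
      + (1 + m.l (x, y) + 2 * m.m33 * z) * t 2 = 0 := by
    have : _ = (0 : ℝ) := congrArg (fun T : ℝ × ℝ →L[ℝ] ℝ => T (0, 1)) hF
    simp at this
    simp only [l]
    linear_combination this
  have hdet : T.det = s 0 * t 1 - s 1 * t 0 := by
    rw [ContinuousLinearMap.det_prod_real, hTeq]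
    change s 0 * t 1 - t 0 * s 1 = _
    ring
  rw [areaDensity_eq, density, ← Real.sqrt_sq_eq_abs, ← Real.sqrt_mul (sq_nonneg _), hdet]
  change √((s 1 * t 2 - s 2 * t 1) ^ 2 + (s 2 * t 0 - s 0 * t 2) ^ 2
    + (s 0 * t 1 - s 1 * t 0) ^ 2) = _
  congr 1
  set c := 1 + m.l (x, y) + 2 * m.m33 * z
  set a := 2 * m.m11 * x + m.m13 * z
  set b := 2 * m.m22 * y + m.m23 * z
  have e1 : s 1 * t 2 - s 2 * t 1 = a / c * (s 0 * t 1 - s 1 * t 0) := by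
    field_simp
    linear_combination s 1 * ht - t 1 * hs
  have e2 : s 2 * t 0 - s 0 * t 2 = b / c * (s 0 * t 1 - s 1 * t 0) := by
    field_simp
    linear_combination t 0 * hs - s 0 * ht
  rw [e1, e2]
  field_simp
  ring

theorem norm_sq_fin_three (v : E3) : ‖v‖ ^ 2 = v 0 ^ 2 + v 1 ^ 2 + v 2 ^ 2 := by
  rw [EuclideanSpace.norm_sq_eq, Fin.sum_univ_three]; simp

theorem abs_lt_of_mem_disk {x : ℝ × ℝ} {r : ℝ} (hr : 0 ≤ r) (hx : x ∈ m.disk r) :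
    |x.1| < r ∧ |x.2| < r := by
  have h : x.1 ^ 2 + x.2 ^ 2 + m.graph x ^ 2 < r ^ 2 := hx
  exact ⟨abs_lt_of_sq_lt_sq (by nlinarith [sq_nonneg x.2, sq_nonneg (m.graph x)]) hr,
    abs_lt_of_sq_lt_sq (by nlinarith [sq_nonneg x.1, sq_nonneg (m.graph x)]) hr⟩

theorem denom_pos {x : ℝ × ℝ} {z : ℝ} (h1 : |x.1| < m.rad) (h2 : |x.2| < m.rad)
    (h3 : |z| < m.rad) : 1 / 2 ≤ 1 + m.l x + 2 * m.m33 * z := by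
  have hl := abs_l_le_of_lt_rad h1 h2
  have hz : |m.m33 * z| ≤ 1 / 16 :=
    (abs_mul_le_of_le m.abs_m33_le h3.le).trans m.bound_mul_rad_le
  rw [abs_le] at hl hz
  linarith [hl.1, hz.1]

/-- Change of variables by the planar projection of the parametrization: the Jacobian factor of
`areaDensity_eq_density` cancels, and the right side no longer involves `X`. -/
theorem setIntegral_searchRegion {U : Set (ℝ × ℝ)} {X : ℝ × ℝ → E3}
    (h : IsLocalParametrization m.surface 0 U X) {r : ℝ} (hr : 0 < r) (hrad : r ≤ m.rad)
    (hcov : m.surface ∩ Metric.ball 0 r ⊆ X '' U) (f : E3 → ℝ) :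
    ∫ p in searchRegion U X 0 r, f (X p) * areaDensity X p
      = ∫ x in m.disk r, f !₂[x.1, x.2, m.graph x] * m.density x (m.graph x) := by
  set N := searchRegion U X 0 r
  have hN : ∀ p ∈ N, p ∈ U ∧ ‖X p‖ < r := fun p hp => by simpa [N, searchRegion] using hp
  have hgraph : ∀ p ∈ N, X p 2 = m.graph (X p 0, X p 1) := fun p hp =>
    eq_graph_of_mem (h.mapsTo (hN p hp).1) ((hN p hp).2.trans_le hrad)
  have hNopen : IsOpen N := by
    have : N = U ∩ X ⁻¹' Metric.ball 0 r := by
      ext p; simp [N, searchRegion]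
    rw [this]
    exact h.contDiffOn.continuousOn.isOpen_inter_preimage h.isOpen Metric.isOpen_ball
  have hdiff : ∀ p ∈ N, DifferentiableAt ℝ X p := fun p hp =>
    (h.contDiffOn.contDiffAt (h.isOpen.mem_nhds (hN p hp).1)).differentiableAt (by simp)
  have himage : (fun p => (X p 0, X p 1)) '' N = m.disk r := by
    ext x
    constructor
    · rintro ⟨p, hp, rfl⟩
      simp only [disk, mem_ofPred_eq]
      rw [← hgraph p hp, ← norm_sq_fin_three]
      have := (hN p hp).2
      gcongr
    · intro hx
      obtain ⟨h1, h2⟩ := abs_lt_of_mem_disk hr.le hx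
      have hn : ‖(!₂[x.1, x.2, m.graph x] : E3)‖ < r := by
        refine lt_of_pow_lt_pow_left₀ 2 hr.le ?_
        rw [norm_sq_fin_three]
        simpa using! hx
      obtain ⟨p, hpU, hp⟩ := hcov ⟨toLp_graph_mem (h1.trans_le hrad) (h2.trans_le hrad),
        mem_ball_zero_iff.mpr hn⟩
      refine ⟨p, ⟨hpU, by simpa [hp] using hn⟩, ?_⟩
      simp [hp]
  -- Inside radius `rad` the planar coordinates determine the height, hence the point of the
  -- surface, hence the parameter.
  have hinj : InjOn (fun p => (X p 0, X p 1)) N := by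
    intro p hp p' hp' heq
    refine h.injOn (hN p hp).1 (hN p' hp').1 ?_
    have hg := (hgraph p hp).trans ((congrArg m.graph heq).trans (hgraph p' hp').symm)
    ext i
    fin_cases i
    · exact congrArg Prod.fst heq
    · exact congrArg Prod.snd heq
    · exact hg
  have hderiv : ∀ p ∈ N, HasFDerivAt (fun p => (X p 0, X p 1))
      (fderiv ℝ (fun p => (X p 0, X p 1)) p) p := fun p hp =>
    ((fderiv_euclidean_apply (hdiff p hp) 0).prodMk
      (fderiv_euclidean_apply (hdiff p hp) 1)).differentiableAt.hasFDerivAt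
  rw [← himage, integral_image_eq_integral_abs_det_fderiv_smul volume hNopen.measurableSet
    (fun p hp => (hderiv p hp).hasFDerivWithinAt) hinj]
  refine setIntegral_congr_fun hNopen.measurableSet fun p hp => ?_
  have hn := (hN p hp).2.trans_le hrad
  have hS : ∀ᶠ p' in 𝓝 p, X p' ∈ m.surface := by
    filter_upwards [h.isOpen.mem_nhds (hN p hp).1] with p' hp' using h.mapsTo hp'
  have hz : 1 + m.l (X p 0, X p 1) + 2 * m.m33 * X p 2 ≠ 0 := by
    have := denom_pos (m := m) (x := (X p 0, X p 1)) (coord_lt hn 0) (coord_lt hn 1)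
      (coord_lt hn 2)
    linarith
  have hv : (!₂[X p 0, X p 1, X p 2] : E3) = X p := by
    ext i; fin_cases i <;> rfl
  simp only [smul_eq_mul]
  rw [areaDensity_eq_density (hdiff p hp) hS hz (hderiv p hp), ← hgraph p hp, hv]
  ring

end QuadricCoeffs

/-! ### Calculus of expansions in ϱ that are uniform in the direction. -/

/-- The unit circle. -/
def unitCircle : Set (ℝ × ℝ) := {n | n.1 ^ 2 + n.2 ^ 2 = 1}

/-- The filter of polar coordinates `(ϱ, n)` with `ϱ → 0+`, uniformly in the direction `n`. -/
def polarFilter : Filter (ℝ × (ℝ × ℝ)) := 𝓝[>] (0 : ℝ) ×ˢ 𝓟 unitCircle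

theorem eventually_polarFilter {P : ℝ × (ℝ × ℝ) → Prop} :
    (∀ᶠ p in polarFilter, P p) ↔
      ∃ δ > 0, ∀ ϱ : ℝ, 0 < ϱ → ϱ < δ → ∀ n ∈ unitCircle, P (ϱ, n) := by
  have hb : (𝓝[>] (0 : ℝ) ×ˢ 𝓟 unitCircle).HasBasis (fun δ : ℝ => 0 < δ)
      fun δ => Ioo 0 δ ×ˢ unitCircle := by
    have := (nhdsGT_basis (0 : ℝ)).prod (hasBasis_principal unitCircle)
    refine this.to_hasBasis ?_ ?_
    · rintro ⟨δ, _⟩ ⟨h, -⟩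
      exact ⟨δ, h, subset_rfl⟩
    · intro δ h
      exact ⟨(δ, ()), ⟨h, trivial⟩, subset_rfl⟩
  rw [polarFilter, hb.eventually_iff]
  constructor
  · rintro ⟨δ, hδ, h⟩
    exact ⟨δ, hδ, fun ϱ h0 h1 n hn => h ⟨⟨h0, h1⟩, hn⟩⟩
  · rintro ⟨δ, hδ, h⟩
    exact ⟨δ, hδ, fun p hp => h p.1 hp.1.1 hp.1.2 p.2 hp.2⟩

theorem isCompact_unitCircle : IsCompact unitCircle := by
  refine Metric.isCompact_of_isClosed_isBounded ?_ ?_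
  · exact isClosed_eq (by fun_prop) continuous_const
  · refine (Metric.isBounded_iff_subset_closedBall 0).mpr ⟨1, fun n hn => ?_⟩
    have hn : n.1 ^ 2 + n.2 ^ 2 = 1 := hn
    rw [mem_closedBall_zero_iff, Prod.norm_def, max_le_iff]
    exact ⟨abs_le_one_iff_mul_self_le_one.mpr (by nlinarith [sq_nonneg n.2]),
      abs_le_one_iff_mul_self_le_one.mpr (by nlinarith [sq_nonneg n.1])⟩

theorem isBigO_one_of_continuous_polar {Φ : ℝ × (ℝ × ℝ) → ℝ} (h : Continuous Φ) :
    Φ =O[polarFilter] fun _ => (1 : ℝ) := by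
  obtain ⟨C, hC⟩ := ((isCompact_Icc (a := (0 : ℝ)) (b := 1)).prod
    isCompact_unitCircle).exists_bound_of_continuousOn h.continuousOn
  refine IsBigO.of_bound C (eventually_polarFilter.mpr ⟨1, one_pos, fun ϱ h0 h1 n hn => ?_⟩)
  simpa using hC (ϱ, n) ⟨⟨h0.le, h1.le⟩, hn⟩

/-- `f` and `g` agree up to `O(ϱ ^ n)`, uniformly in the direction. -/
def Approx (n : ℕ) (f g : ℝ × (ℝ × ℝ) → ℝ) : Prop :=
  (fun p => f p - g p) =O[polarFilter] fun p => p.1 ^ n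

namespace Approx

variable {n k : ℕ} {f g h f' g' : ℝ × (ℝ × ℝ) → ℝ}

theorem trans (h1 : Approx n f g) (h2 : Approx n g h) : Approx n f h := by
  refine (IsBigO.add h1 h2).congr_left fun p => ?_
  ring

theorem add (h1 : Approx n f g) (h2 : Approx n f' g') :
    Approx n (fun p => f p + f' p) fun p => g p + g' p := by
  refine (IsBigO.add h1 h2).congr_left fun p => ?_
  ring

/-- Truncation errors are handled by exhibiting the remainder as ϱⁿΦ; compactness of the circle
bounds the continuous factor Φ uniformly in the direction. -/
theorem of_eq (Φ : ℝ × (ℝ × ℝ) → ℝ) (hΦ : Continuous Φ) (h1 : ∀ p, f p - g p = p.1 ^ n * Φ p) :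
    Approx n f g := by
  have := (isBigO_refl (fun p : ℝ × (ℝ × ℝ) => p.1 ^ n) polarFilter).mul
    (isBigO_one_of_continuous_polar hΦ)
  simp only [mul_one] at this
  exact this.congr_left fun p => (h1 p).symm

theorem refl (f : ℝ × (ℝ × ℝ) → ℝ) : Approx n f f :=
  of_eq (fun _ => 0) continuous_const (by simp)

theorem pow_isBigO_one : (fun p : ℝ × (ℝ × ℝ) => p.1 ^ n) =O[polarFilter] fun _ => (1 : ℝ) :=
  isBigO_one_of_continuous_polar (by fun_prop)

theorem isBigO_one (h1 : Approx n f g) (hg : Continuous g) :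
    f =O[polarFilter] fun _ => (1 : ℝ) := by
  refine ((IsBigO.trans h1 pow_isBigO_one).add (isBigO_one_of_continuous_polar hg)).congr_left
    fun p => ?_
  ring

theorem mul (h1 : Approx n f g) (h2 : Approx n f' g') (hg : Continuous g) (hg' : Continuous g') :
    Approx n (fun p => f p * f' p) fun p => g p * g' p := by
  have h3 := IsBigO.mul h1 (h2.isBigO_one hg')
  have h4 := IsBigO.mul (isBigO_one_of_continuous_polar hg) h2
  simp only [mul_one, one_mul] at h3 h4
  refine (h3.add h4).congr_left fun p => ?_
  ring

theorem const_mul (h1 : Approx n f g) (hf' : Continuous f') :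
    Approx n (fun p => f' p * f p) fun p => f' p * g p := by
  have h4 := IsBigO.mul (isBigO_one_of_continuous_polar hf') h1
  simp only [one_mul] at h4
  exact h4.congr_left fun p => by ring

theorem pow_mul (h1 : Approx n f g) (k : ℕ) :
    Approx (n + k) (fun p => p.1 ^ k * f p) fun p => p.1 ^ k * g p := by
  have := (isBigO_refl (fun p : ℝ × (ℝ × ℝ) => p.1 ^ k) polarFilter).mul h1
  refine (this.congr_left fun p => ?_).congr_right fun p => ?_
  · ring
  · ring

theorem mono (h1 : Approx n f g) (hk : k ≤ n) : Approx k f g := by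
  refine IsBigO.trans h1 (IsBigO.of_bound 1
    (eventually_polarFilter.mpr ⟨1, one_pos, fun ϱ h0 h1 n hn => ?_⟩))
  rw [Real.norm_of_nonneg (by positivity), Real.norm_of_nonneg (by positivity), one_mul]
  exact pow_le_pow_of_le_one h0.le h1.le hk

theorem congr_left (h1 : Approx n f g) (h2 : ∀ᶠ p in polarFilter, f p = h p) : Approx n h g :=
  IsBigO.congr' h1 (by filter_upwards [h2] with p hp; rw [hp]) EventuallyEq.rfl

/-- The approximation of a reciprocal. -/
theorem inv (hf : ∀ᶠ p in polarFilter, 1 / 2 ≤ f p)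
    (h1 : Approx n (fun p => f p * g p) fun _ => 1) : Approx n (fun p => (f p)⁻¹) g := by
  refine IsBigO.trans (IsBigO.of_bound 2 ?_) h1
  filter_upwards [hf] with p hp
  have hp0 : 0 < f p := by linarith
  have : (f p)⁻¹ - g p = (f p)⁻¹ * -(f p * g p - 1) := by field_simp; ring
  rw [this, norm_mul, norm_neg, norm_inv, Real.norm_of_nonneg hp0.le]
  gcongr
  rw [inv_le_comm₀ hp0 (by norm_num)]
  linarith

end Approx

/-! ### Expansion of the slope and of the area density. -/

namespace QuadricCoeffs

variable (m : QuadricCoeffs)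

@[fun_prop]
theorem continuous_q : Continuous m.q := by unfold q; fun_prop

@[fun_prop]
theorem continuous_l : Continuous m.l := by unfold l; fun_prop

/-- The slope `z / ϱ` at the point of the surface with planar polar coordinates `(ϱ, n)`. -/
noncomputable def slope (p : ℝ × (ℝ × ℝ)) : ℝ :=
  m.graph (p.1 * p.2.1, p.1 * p.2.2) / p.1

variable {m}

theorem eventually_lt_rad : ∀ᶠ p in polarFilter, 0 < p.1 ∧ p.2 ∈ unitCircle ∧
    |p.1 * p.2.1| < m.rad ∧ |p.1 * p.2.2| < m.rad := by
  refine eventually_polarFilter.mpr ⟨m.rad, m.rad_pos, fun ϱ h0 h1 n hn => ⟨h0, hn, ?_, ?_⟩⟩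
  · have hn : n.1 ^ 2 + n.2 ^ 2 = 1 := hn
    have : |n.1| ≤ 1 := abs_le_one_iff_mul_self_le_one.mpr (by nlinarith [sq_nonneg n.2])
    rw [abs_mul, abs_of_pos h0]
    nlinarith
  · have hn : n.1 ^ 2 + n.2 ^ 2 = 1 := hn
    have : |n.2| ≤ 1 := abs_le_one_iff_mul_self_le_one.mpr (by nlinarith [sq_nonneg n.1])
    rw [abs_mul, abs_of_pos h0]
    nlinarith

theorem q_smul (c : ℝ) (x : ℝ × ℝ) : m.q (c * x.1, c * x.2) = c ^ 2 * m.q x := by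
  simp only [q]; ring

theorem l_smul (c : ℝ) (x : ℝ × ℝ) : m.l (c * x.1, c * x.2) = c * m.l x := by
  simp only [l]; ring

/-- This is the equation of the surface at z = ϱ · slope, divided by ϱ². -/
theorem slope_eq : ∀ᶠ p in polarFilter,
    m.slope p = -p.1 * (m.q p.2 + m.l p.2 * m.slope p + m.m33 * m.slope p ^ 2) := by
  filter_upwards [eventually_lt_rad (m := m)] with p ⟨h0, _, h1, h2⟩
  have := graph_eq (m := m) (x := (p.1 * p.2.1, p.1 * p.2.2)) h1 h2
  rw [q_smul, l_smul] at this
  have hs : m.graph (p.1 * p.2.1, p.1 * p.2.2) = p.1 * m.slope p := by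
    rw [slope]; field_simp
  rw [hs] at this
  have h3 : p.1 * (m.slope p + p.1 * (m.q p.2 + m.l p.2 * m.slope p + m.m33 * m.slope p ^ 2))
      = 0 := by linear_combination this
  have := (mul_eq_zero.mp h3).resolve_left h0.ne'
  linear_combination this

theorem slope_approx_one : Approx 1 m.slope fun _ => 0 := by
  have h1 : m.slope =O[polarFilter] fun p => p.1 ^ 1 * (2 * m.q p.2) := by
    refine IsBigO.of_bound 1 ?_
    filter_upwards [eventually_lt_rad (m := m)] with p ⟨h0, _, h1, h2⟩
    have := abs_graph_le (m := m) (x := (p.1 * p.2.1, p.1 * p.2.2)) h1 h2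
    rw [q_smul, abs_mul, abs_of_pos (by positivity : 0 < p.1 ^ 2)] at this
    rw [slope, norm_div, Real.norm_eq_abs, Real.norm_of_nonneg h0.le, div_le_iff₀ h0,
      norm_mul, norm_mul, Real.norm_of_nonneg (by positivity), Real.norm_two, Real.norm_eq_abs]
    linarith
  have h2 : Approx 1 (fun p => p.1 ^ 1 * (2 * m.q p.2)) fun _ => 0 :=
    Approx.of_eq (fun p => 2 * m.q p.2) (by fun_prop) (by intro p; ring)
  unfold Approx at *
  simp only [sub_zero] at *
  exact h1.trans h2

/-- The factor ϱ in `slope_eq` makes each substitution of an approximation into the right side gain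
one order. -/
theorem slope_approx_succ {n : ℕ} {T : ℝ × (ℝ × ℝ) → ℝ} (hT : Continuous T)
    (h : Approx n m.slope T) :
    Approx (n + 1) m.slope
      fun p => p.1 ^ 1 * (-(m.q p.2 + m.l p.2 * T p + m.m33 * (T p * T p))) := by
  have h1 : Approx n
      (fun p => -1 * (m.q p.2 + m.l p.2 * m.slope p + m.m33 * (m.slope p * m.slope p)))
      fun p => -1 * (m.q p.2 + m.l p.2 * T p + m.m33 * (T p * T p)) :=
    (((Approx.refl fun p => m.q p.2).add (h.const_mul (f' := fun p => m.l p.2) (by fun_prop))).add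
      ((h.mul h hT hT).const_mul (f' := fun _ => m.m33) continuous_const)).const_mul
        (f' := fun _ => -1) continuous_const
  have h2 := (h1.pow_mul 1).congr_left (h := m.slope) (by
    filter_upwards [slope_eq (m := m)] with p hp
    linear_combination -hp)
  exact h2.trans (Approx.of_eq (fun _ => 0) continuous_const (by intro p; ring))

theorem slope_approx_two : Approx 2 m.slope fun p => -p.1 * m.q p.2 :=
  (slope_approx_succ continuous_const slope_approx_one).trans
    (Approx.of_eq (fun _ => 0) continuous_const (by intro p; ring))

theorem slope_approx_three :
    Approx 3 m.slope fun p => -p.1 * m.q p.2 + p.1 ^ 2 * (m.q p.2 * m.l p.2) :=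
  (slope_approx_succ (by fun_prop) slope_approx_two).trans
    (Approx.of_eq (fun p => -m.m33 * m.q p.2 ^ 2) (by fun_prop) (by intro p; ring))

/-- The expansion of the slope. -/
def slopePoly (m : QuadricCoeffs) (p : ℝ × (ℝ × ℝ)) : ℝ :=
  -p.1 * m.q p.2 + p.1 ^ 2 * (m.q p.2 * m.l p.2)
    - p.1 ^ 3 * (m.q p.2 * m.l p.2 ^ 2 + m.m33 * m.q p.2 ^ 2)

@[fun_prop]
theorem continuous_slopePoly : Continuous m.slopePoly := by unfold slopePoly; fun_prop

theorem slope_approx_four : Approx 4 m.slope m.slopePoly :=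
  (slope_approx_succ (by fun_prop) slope_approx_three).trans
    (Approx.of_eq (fun p => m.m33 * m.q p.2 ^ 2 * (2 * m.l p.2 - p.1 * m.l p.2 ^ 2)) (by fun_prop)
      (by intro p; unfold slopePoly; ring))

theorem slope_sq_approx : Approx 4 (fun p => m.slope p * m.slope p)
    fun p => p.1 ^ 2 * m.q p.2 ^ 2 - 2 * p.1 ^ 3 * (m.q p.2 ^ 2 * m.l p.2) := by
  refine (slope_approx_four.mul slope_approx_four (by fun_prop) (by fun_prop)).trans
    (Approx.of_eq (fun p => m.q p.2 ^ 2 * (m.l p.2 ^ 2 + 2 * (m.l p.2 ^ 2 + m.m33 * m.q p.2)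
      - 2 * p.1 * m.l p.2 * (m.l p.2 ^ 2 + m.m33 * m.q p.2)
      + p.1 ^ 2 * (m.l p.2 ^ 2 + m.m33 * m.q p.2) ^ 2)) (by fun_prop) ?_)
  intro p
  unfold slopePoly
  ring

theorem inv_one_add_slope_sq_approx : Approx 4 (fun p => (1 + m.slope p * m.slope p)⁻¹)
    fun p => 1 - (p.1 ^ 2 * m.q p.2 ^ 2 - 2 * p.1 ^ 3 * (m.q p.2 ^ 2 * m.l p.2)) := by
  refine Approx.inv (Eventually.of_forall fun p => ?_) ?_
  · nlinarith [mul_self_nonneg (m.slope p)]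
  · refine (((Approx.refl fun _ => 1).add slope_sq_approx).mul (Approx.refl _) (by fun_prop)
      (by fun_prop)).trans (Approx.of_eq
        (fun p => -(m.q p.2 ^ 2 - 2 * p.1 * (m.q p.2 ^ 2 * m.l p.2)) ^ 2) (by fun_prop) ?_)
    intro p
    ring

/-- The quadratic part of the squared gradient of the surface. -/
def gradSq (m : QuadricCoeffs) (n : ℝ × ℝ) : ℝ :=
  4 * (m.m11 ^ 2 * n.1 ^ 2 + m.m22 ^ 2 * n.2 ^ 2)

/-- The cubic part of the squared gradient of the surface. -/
def gradCub (m : QuadricCoeffs) (n : ℝ × ℝ) : ℝ :=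
  -4 * m.q n * (m.m11 * m.m13 * n.1 + m.m22 * m.m23 * n.2) - 2 * m.l n * m.gradSq n

@[fun_prop]
theorem continuous_gradSq : Continuous m.gradSq := by unfold gradSq; fun_prop

@[fun_prop]
theorem continuous_gradCub : Continuous m.gradCub := by unfold gradCub; fun_prop

/-- The area density in planar polar coordinates. -/
noncomputable def polarDensity (m : QuadricCoeffs) (p : ℝ × (ℝ × ℝ)) : ℝ :=
  m.density (p.1 * p.2.1, p.1 * p.2.2) (m.graph (p.1 * p.2.1, p.1 * p.2.2))

/-- For V = O(ϱ²) the error V² is O(ϱ⁴), so linearizing the root in the area density suffices. -/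
theorem abs_sqrt_one_add_sub_le {V : ℝ} (hV : 0 ≤ V) : |√(1 + V) - (1 + V / 2)| ≤ V ^ 2 := by
  have h1 : √(1 + V) ≤ 1 + V / 2 := Real.sqrt_le_iff.mpr ⟨by linarith, by nlinarith⟩
  have h2 : 1 ≤ √(1 + V) := Real.one_le_sqrt.mpr (by linarith)
  have h3 := Real.sq_sqrt (by linarith : 0 ≤ 1 + V)
  rw [abs_le]
  constructor <;> nlinarith

theorem polarDensity_approx : Approx 4 m.polarDensity
    fun p => 1 + p.1 ^ 2 * (m.gradSq p.2 / 2) + p.1 ^ 3 * (m.gradCub p.2 / 2) := by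
  -- The squared gradient of the graph carries a factor ϱ², so its remaining factors are needed only
  -- up to O(ϱ²).
  have hz : Approx 2 (fun p => 1 + (p.1 * m.l p.2 + 2 * m.m33 * p.1 * m.slope p))
      fun p => 1 + p.1 * m.l p.2 :=
    ((Approx.refl fun _ => 1).add ((Approx.refl fun p => p.1 * m.l p.2).add
      (slope_approx_two.const_mul (f' := fun p => 2 * m.m33 * p.1) (by fun_prop)))).trans
      (Approx.of_eq (fun p => -2 * m.m33 * m.q p.2) (by fun_prop) (by intro p; ring))
  have hzpos : ∀ᶠ p in polarFilter, 3 / 4 ≤ 1 + (p.1 * m.l p.2 + 2 * m.m33 * p.1 * m.slope p) := by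
    have h1 : Approx 1 (fun p => 1 + (p.1 * m.l p.2 + 2 * m.m33 * p.1 * m.slope p)) fun _ => 1 :=
      (hz.mono (by norm_num)).trans
        (Approx.of_eq (fun p => m.l p.2) (by fun_prop) (by intro p; ring))
    obtain ⟨C, hC, h2⟩ := h1.exists_pos
    have h3 : ∀ᶠ p in polarFilter, C * p.1 < 1 / 4 ∧ 0 < p.1 :=
      eventually_polarFilter.mpr ⟨1 / (4 * C), by positivity, fun ϱ h0 h1 n _ => ⟨by
        rw [lt_div_iff₀ (by positivity)] at h1
        dsimp only
        linarith, h0⟩⟩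
    filter_upwards [h2.bound, h3] with p h4 ⟨h5, h6⟩
    rw [pow_one, Real.norm_of_nonneg h6.le, Real.norm_eq_abs, abs_le] at h4
    linarith [h4.1]
  have hinv : Approx 2 (fun p => ((1 + (p.1 * m.l p.2 + 2 * m.m33 * p.1 * m.slope p))
      * (1 + (p.1 * m.l p.2 + 2 * m.m33 * p.1 * m.slope p)))⁻¹)
      fun p => 1 - 2 * p.1 * m.l p.2 := by
    refine Approx.inv ?_ ?_
    · filter_upwards [hzpos] with p hp
      nlinarith
    · refine ((hz.mul hz (by fun_prop) (by fun_prop)).mul (Approx.refl _) (by fun_prop)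
        (by fun_prop)).trans (Approx.of_eq
          (fun p => -3 * m.l p.2 ^ 2 - 2 * p.1 * m.l p.2 ^ 3) (by fun_prop) ?_)
      intro p; ring
  have ha : Approx 2 (fun p => 2 * m.m11 * p.2.1 + m.m13 * m.slope p)
      fun p => 2 * m.m11 * p.2.1 + m.m13 * (-p.1 * m.q p.2) :=
    (Approx.refl _).add (slope_approx_two.const_mul continuous_const)
  have hb : Approx 2 (fun p => 2 * m.m22 * p.2.2 + m.m23 * m.slope p)
      fun p => 2 * m.m22 * p.2.2 + m.m23 * (-p.1 * m.q p.2) :=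
    (Approx.refl _).add (slope_approx_two.const_mul continuous_const)
  have hab := (((ha.mul ha (by fun_prop) (by fun_prop)).add
    (hb.mul hb (by fun_prop) (by fun_prop))).trans (h := fun p => m.gradSq p.2
      + p.1 * (-4 * m.q p.2 * (m.m11 * m.m13 * p.2.1 + m.m22 * m.m23 * p.2.2)))
    (Approx.of_eq (fun p => (m.m13 ^ 2 + m.m23 ^ 2) * m.q p.2 ^ 2) (by fun_prop)
      (by intro p; simp only [gradSq]; ring))).mul hinv (by fun_prop) (by fun_prop)
  have hv := hab.trans (h := fun p => m.gradSq p.2 + p.1 * m.gradCub p.2)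
    (Approx.of_eq (fun p => 8 * m.q p.2 * m.l p.2
      * (m.m11 * m.m13 * p.2.1 + m.m22 * m.m23 * p.2.2)) (by fun_prop)
      (by intro p; simp only [gradCub]; ring))
  have hV := hv.pow_mul 2
  set V : ℝ × (ℝ × ℝ) → ℝ := fun p => p.1 ^ 2 *
    (((2 * m.m11 * p.2.1 + m.m13 * m.slope p) * (2 * m.m11 * p.2.1 + m.m13 * m.slope p)
      + (2 * m.m22 * p.2.2 + m.m23 * m.slope p) * (2 * m.m22 * p.2.2 + m.m23 * m.slope p))
      * ((1 + (p.1 * m.l p.2 + 2 * m.m33 * p.1 * m.slope p))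
      * (1 + (p.1 * m.l p.2 + 2 * m.m33 * p.1 * m.slope p)))⁻¹) with hVdef
  have hVnn : ∀ p, 0 ≤ V p := fun p =>
    mul_nonneg (sq_nonneg _) (mul_nonneg (add_nonneg (mul_self_nonneg _) (mul_self_nonneg _))
      (inv_nonneg.mpr (mul_self_nonneg _)))
  have hVO : V =O[polarFilter] fun p => p.1 ^ 2 := by
    have h1 : Approx 2 V fun _ => 0 := (hV.mono (by norm_num)).trans
      (Approx.of_eq (fun p => m.gradSq p.2 + p.1 * m.gradCub p.2) (by fun_prop)
        (by intro p; ring))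
    simpa [Approx] using h1
  have hsqrt : Approx 4 (fun p => √(1 + V p)) fun p => 1 + V p / 2 := by
    have h1 : (fun p => √(1 + V p) - (1 + V p / 2)) =O[polarFilter] fun p => V p ^ 2 :=
      IsBigO.of_bound 1 (Eventually.of_forall fun p => by
        rw [one_mul, Real.norm_eq_abs, Real.norm_of_nonneg (sq_nonneg _)]
        exact abs_sqrt_one_add_sub_le (hVnn p))
    refine (h1.trans (hVO.pow 2)).congr_right fun p => ?_
    ring
  have hmain := hsqrt.trans ((Approx.refl fun _ => 1).add
    ((hV.const_mul (f' := fun _ => 1 / 2) continuous_const).congr_left (h := fun p => V p / 2)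
      (Eventually.of_forall fun p => by ring)))
  refine (hmain.trans (Approx.of_eq (fun _ => 0) continuous_const ?_)).congr_left ?_
  · intro p; ring
  · filter_upwards [eventually_lt_rad (m := m)] with p ⟨h0, _⟩
    have hs : m.graph (p.1 * p.2.1, p.1 * p.2.2) = p.1 * m.slope p := by
      rw [slope]; field_simp
    rw [polarDensity, density, hs, l_smul, hVdef]
    congr 2
    rw [div_eq_mul_inv]
    ring_nf

end QuadricCoeffs

/-! ### The boundary of the projected neighbourhood. -/

/-- The radial slice `A` need not be known to be an interval: being squeezed between (0, a) and (0,
b) is enough. The factor 2 arises because the integrals of `P` over `A` and over (0, R) are each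
compared with the one over (0, a). -/
theorem abs_setIntegral_sub_le {f P : ℝ → ℝ} {A : Set ℝ} {a b R ε K : ℝ} (hf : Measurable f)
    (hP : Continuous P) (hA : MeasurableSet A) (ha : 0 < a) (haR : a ≤ R) (hRb : R ≤ b)
    (hAb : A ⊆ Ioo 0 b) (haA : Ioo 0 a ⊆ A) (hε : ∀ x ∈ Ioo 0 b, |f x - P x| ≤ ε)
    (hK : ∀ x ∈ Icc 0 b, |P x| ≤ K) :
    |(∫ x in A, f x) - ∫ x in (0 : ℝ)..R, P x| ≤ ε * b + 2 * (K * (b - a)) := by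
  have hvA : volume A < ⊤ := (measure_mono hAb).trans_lt (by simp)
  have hPi : ∀ s : Set ℝ, s ⊆ Icc 0 b → IntegrableOn P s := fun s hs =>
    (hP.continuousOn.integrableOn_compact isCompact_Icc).mono_set hs
  have hAb' : A ⊆ Icc 0 b := hAb.trans Ioo_subset_Icc_self
  have hb : 0 < b := by linarith
  have hε0 : 0 ≤ ε := (abs_nonneg _).trans (hε (b / 2) ⟨by linarith, by linarith⟩)
  have hK0 : 0 ≤ K := (abs_nonneg _).trans (hK 0 ⟨le_rfl, hb.le⟩)
  have hfi : IntegrableOn f A := by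
    refine Measure.integrableOn_of_bounded hvA.ne hf.aestronglyMeasurable (M := ε + K) ?_
    filter_upwards [ae_restrict_mem hA] with x hx
    have h1 := hε x (hAb hx)
    have h2 := hK x (hAb' hx)
    rw [abs_le] at h1 h2
    rw [Real.norm_eq_abs, abs_le]
    constructor <;> linarith [h1.1, h1.2, h2.1, h2.2]
  have e1 : |(∫ x in A, f x) - ∫ x in A, P x| ≤ ε * b := by
    rw [← integral_sub hfi (hPi A hAb')]
    refine (norm_setIntegral_le_of_norm_le_const (f := fun x => f x - P x) (C := ε) hvA
      fun x hx => hε x (hAb hx)).trans ?_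
    gcongr
    refine (measureReal_mono hAb (by simp)).trans ?_
    rw [Real.volume_real_Ioo_of_le hb.le, sub_zero]
  have hrem : ∀ s : Set ℝ, s ⊆ Icc 0 b → Ioo 0 a ⊆ s →
      |(∫ x in s, P x) - ∫ x in Ioo 0 a, P x| ≤ K * (b - a) := by
    intro s hs has
    rw [← setIntegral_sdiff measurableSet_Ioo (hPi s hs) has]
    have hsub : s \ Ioo 0 a ⊆ {0} ∪ Icc a b := by
      rintro x ⟨hx, hx'⟩
      have := hs hx
      by_cases h0 : x = 0
      · exact Or.inl h0
      · refine Or.inr ⟨?_, this.2⟩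
        by_contra hlt
        exact hx' ⟨lt_of_le_of_ne this.1 (Ne.symm h0), not_le.mp hlt⟩
    have hvol : volume ({0} ∪ Icc a b) < ⊤ :=
      (measure_union_le _ _).trans_lt (by simp)
    refine (norm_setIntegral_le_of_norm_le_const (f := P) (C := K)
      ((measure_mono hsub).trans_lt hvol)
      fun x hx => hK x (hs hx.1)).trans ?_
    gcongr
    refine (measureReal_mono hsub hvol.ne).trans ((measureReal_union_le _ _).trans ?_)
    rw [Real.volume_real_Icc_of_le (haR.trans hRb)]
    simp [Measure.real]
  have e2 := hrem A hAb' haA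
  have e3 := hrem (Ioc 0 R) (fun x hx => ⟨hx.1.le, hx.2.trans hRb⟩)
    (fun x hx => ⟨hx.1, hx.2.le.trans haR⟩)
  rw [intervalIntegral.integral_of_le (ha.le.trans haR)]
  rw [abs_le] at *
  constructor <;> linarith [e1.1, e1.2, e2.1, e2.2, e3.1, e3.2]

theorem exists_bound_unitCircle {g : ℝ × ℝ → ℝ} (hg : Continuous g) :
    ∃ C > 0, ∀ n ∈ unitCircle, |g n| ≤ C := by
  obtain ⟨C, hC⟩ := isCompact_unitCircle.exists_bound_of_continuousOn hg.continuousOn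
  exact ⟨max C 1, by positivity, fun n hn => (hC n hn).trans (le_max_left _ _)⟩

theorem Approx.exists_bound {n : ℕ} {f g : ℝ × (ℝ × ℝ) → ℝ} (h : Approx n f g) :
    ∃ C > 0, ∃ δ > 0, ∀ ϱ : ℝ, 0 < ϱ → ϱ < δ → ∀ x ∈ unitCircle,
      |f (ϱ, x) - g (ϱ, x)| ≤ C * ϱ ^ n := by
  obtain ⟨C, hC, h1⟩ := h.exists_pos
  obtain ⟨δ, hδ, h2⟩ := eventually_polarFilter.mp h1.bound
  refine ⟨C, hC, δ, hδ, fun ϱ h0 hd x hx => ?_⟩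
  have := h2 ϱ h0 hd x hx
  rwa [Real.norm_eq_abs, Real.norm_of_nonneg (by positivity)] at this

/-- With Q = q² and L = q²l, t² + t⁴Q - 2t⁵L is the truncated squared distance to the origin. Its
growth at rate at least half that of t² turns an approximate solution of "squared distance = r²"
into a location of the boundary. -/
theorem half_mul_le_sub {Q L k s x y : ℝ} (hQ : 0 ≤ Q) (hL : |L| ≤ k) (hx : 0 < x) (hxy : x ≤ y)
    (hys : y ≤ s) (hs : 12 * k * s ^ 3 ≤ 1) :
    (y - x) * (y + x) / 2 ≤ (y ^ 2 + y ^ 4 * Q - 2 * y ^ 5 * L)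
      - (x ^ 2 + x ^ 4 * Q - 2 * x ^ 5 * L) := by
  have hk : 0 ≤ k := (abs_nonneg _).trans hL
  set E := y ^ 3 + y * x ^ 2 + x ^ 3
  have hE : E ≤ 3 * s ^ 3 := by
    have h1 : y ^ 3 ≤ s ^ 3 := by gcongr; linarith
    have h2 : x ^ 3 ≤ s ^ 3 := by gcongr; linarith
    have h3 : y * x ^ 2 ≤ s * s ^ 2 := by gcongr <;> linarith
    simp only [E]; linarith [h3.trans_eq (by ring : s * s ^ 2 = s ^ 3)]
  have hy : 0 < y := hx.trans_le hxy
  have hE0 : 0 ≤ E := by positivity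
  set T := y ^ 4 + y ^ 3 * x + y ^ 2 * x ^ 2 + y * x ^ 3 + x ^ 4
  have hT : T ≤ (y + x) * E := by
    have : 0 ≤ y * x ^ 3 := by positivity
    simp only [T, E]; nlinarith
  have hT0 : 0 ≤ T := by positivity
  have hLT : 2 * (L * T) ≤ (y + x) / 2 := by
    calc 2 * (L * T) ≤ 2 * (k * ((y + x) * E)) := by
          gcongr
          exact (le_abs_self L).trans hL
      _ ≤ 2 * (k * ((y + x) * (3 * s ^ 3))) := by gcongr
      _ = (y + x) / 2 * (12 * k * s ^ 3) := by ring
      _ ≤ (y + x) / 2 * 1 := by gcongr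
      _ = _ := mul_one _
  have hid : (y ^ 2 + y ^ 4 * Q - 2 * y ^ 5 * L) - (x ^ 2 + x ^ 4 * Q - 2 * x ^ 5 * L)
      = (y - x) * ((y + x) + (y + x) * (Q * (y ^ 2 + x ^ 2)) - 2 * (L * T)) := by
    simp only [T]; ring
  rw [hid, mul_div_assoc]
  refine mul_le_mul_of_nonneg_left ?_ (by linarith)
  have : 0 ≤ (y + x) * (Q * (y ^ 2 + x ^ 2)) := by positivity
  linarith

namespace QuadricCoeffs

variable {m : QuadricCoeffs}

/-- The expansion of the planar radius of the boundary of the neighbourhood. -/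
noncomputable def radiusPoly (m : QuadricCoeffs) (p : ℝ × (ℝ × ℝ)) : ℝ :=
  p.1 - p.1 ^ 3 * (m.q p.2 ^ 2 / 2) + p.1 ^ 4 * (m.q p.2 ^ 2 * m.l p.2)

/-- The relative decrease of the planar radius, divided by `r ^ 2`. -/
noncomputable def shrink (m : QuadricCoeffs) (p : ℝ × (ℝ × ℝ)) : ℝ :=
  m.q p.2 ^ 2 / 2 - p.1 * (m.q p.2 ^ 2 * m.l p.2)

@[fun_prop]
theorem continuous_shrink : Continuous m.shrink := by unfold shrink; fun_prop

@[fun_prop]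
theorem continuous_radiusPoly : Continuous m.radiusPoly := by unfold radiusPoly; fun_prop

theorem radiusPoly_eq (p : ℝ × (ℝ × ℝ)) : m.radiusPoly p = p.1 - p.1 ^ 3 * m.shrink p := by
  unfold radiusPoly shrink; ring

theorem radiusPoly_sq_approx : Approx 6
    (fun p => m.radiusPoly p ^ 2 + m.radiusPoly p ^ 4 * m.q p.2 ^ 2
      - 2 * m.radiusPoly p ^ 5 * (m.q p.2 ^ 2 * m.l p.2)) fun p => p.1 ^ 2 := by
  refine Approx.of_eq (fun p => m.shrink p ^ 2
    + m.q p.2 ^ 2 * (-4 * m.shrink p + 6 * p.1 ^ 2 * m.shrink p ^ 2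
      - 4 * p.1 ^ 4 * m.shrink p ^ 3 + p.1 ^ 6 * m.shrink p ^ 4)
    - 2 * p.1 * (m.q p.2 ^ 2 * m.l p.2) * (-5 * m.shrink p + 10 * p.1 ^ 2 * m.shrink p ^ 2
      - 10 * p.1 ^ 4 * m.shrink p ^ 3 + 5 * p.1 ^ 6 * m.shrink p ^ 4 - p.1 ^ 8 * m.shrink p ^ 5))
    (by fun_prop) fun p => ?_
  rw [radiusPoly_eq]
  have : m.q p.2 ^ 2 = 2 * m.shrink p + 2 * p.1 * (m.q p.2 ^ 2 * m.l p.2) := by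
    unfold shrink; ring
  linear_combination p.1 ^ 4 * this

theorem mem_disk_iff {ϱ r : ℝ} {n : ℝ × ℝ} (h0 : 0 < ϱ) (hn : n ∈ unitCircle) :
    (ϱ * n.1, ϱ * n.2) ∈ m.disk r ↔ ϱ ^ 2 + ϱ ^ 2 * (m.slope (ϱ, n) * m.slope (ϱ, n)) < r ^ 2 := by
  have hs : m.graph (ϱ * n.1, ϱ * n.2) = ϱ * m.slope (ϱ, n) := by
    rw [slope]; field_simp
  have hn : n.1 ^ 2 + n.2 ^ 2 = 1 := hn
  have : (ϱ * n.1) ^ 2 + (ϱ * n.2) ^ 2 + m.graph (ϱ * n.1, ϱ * n.2) ^ 2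
      = ϱ ^ 2 + ϱ ^ 2 * (m.slope (ϱ, n) * m.slope (ϱ, n)) := by
    rw [hs]; linear_combination ϱ ^ 2 * hn
  simp only [disk, mem_ofPred_eq]
  rw [this]

/-- `radiusPoly` solves the boundary equation up to O(r⁶), and the squared distance has radial
derivative of order r there, so the radius is correct up to O(r⁵). -/
theorem exists_disk_sandwich : ∃ C > 0, ∃ δ > 0, ∀ r : ℝ, 0 < r → r < δ → ∀ n ∈ unitCircle,
    0 < m.radiusPoly (r, n) - C * r ^ 5 ∧ m.radiusPoly (r, n) + C * r ^ 5 ≤ 2 * r ∧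
    (∀ ϱ, 0 < ϱ → ϱ < m.radiusPoly (r, n) - C * r ^ 5 → (ϱ * n.1, ϱ * n.2) ∈ m.disk r) ∧
    ∀ ϱ, 0 < ϱ → (ϱ * n.1, ϱ * n.2) ∈ m.disk r → ϱ < m.radiusPoly (r, n) + C * r ^ 5 := by
  obtain ⟨C1, hC1, δ1, hδ1, h1⟩ := (slope_sq_approx (m := m)).exists_bound
  obtain ⟨C2, hC2, δ2, hδ2, h2⟩ := (radiusPoly_sq_approx (m := m)).exists_bound
  obtain ⟨k1, hk1, hq⟩ := exists_bound_unitCircle (g := fun n => m.q n ^ 2) (by fun_prop)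
  obtain ⟨k, hk, hql⟩ := exists_bound_unitCircle (g := fun n => m.q n ^ 2 * m.l n) (by fun_prop)
  -- Moving by Cr⁵ from R changes the squared distance by at least Cr⁶/4 = (64C₁ + C₂ + 1)r⁶. This
  -- exceeds the slope error, at most C₁(2r)⁶, plus the error C₂r⁶ of the radius equation.
  set C := 4 * (64 * C1 + C2 + 1) with hC
  have hCpos : 0 < C := by positivity
  have hsmall : ∀ᶠ r in 𝓝[>] (0 : ℝ), 2 * r < δ1 ∧ r < δ2 ∧ 96 * k * r ^ 3 ≤ 1 ∧
      (k1 / 2) * r ^ 2 < 1 / 8 ∧ k * r ^ 3 < 1 / 8 ∧ C * r ^ 4 < 1 / 8 := by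
    filter_upwards [eventually_pow_lt hδ1 2 one_ne_zero, eventually_pow_lt hδ2 1 one_ne_zero,
      eventually_pow_lt one_pos (96 * k) three_ne_zero,
      eventually_pow_lt (c := 1 / 8) (by norm_num) (k1 / 2) two_ne_zero,
      eventually_pow_lt (c := 1 / 8) (by norm_num) k three_ne_zero,
      eventually_pow_lt (c := 1 / 8) (by norm_num) C four_ne_zero] with r a1 a2 a3 a4 a5 a6
    rw [pow_one] at a1 a2
    exact ⟨a1, by linarith, a3.le, a4, a5, a6⟩
  obtain ⟨δ, hδ, hδ'⟩ := (nhdsGT_basis (0 : ℝ)).eventually_iff.mp hsmall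
  refine ⟨C, hCpos, δ, hδ, fun r h0 hr n hn => ?_⟩
  obtain ⟨s1, s2, s3, s4, s5, s6⟩ := hδ' ⟨h0, hr⟩
  set R := m.radiusPoly (r, n) with hR
  have hqn := hq n hn
  have hqln := hql n hn
  have hq0 : 0 ≤ m.q n ^ 2 := sq_nonneg _
  rw [abs_of_nonneg hq0] at hqn
  have hCr : C * r ^ 5 < r / 8 := by
    calc C * r ^ 5 = C * r ^ 4 * r := by ring
      _ < 1 / 8 * r := by gcongr
      _ = _ := by ring
  have hCr0 : 0 < C * r ^ 5 := by positivity
  have hRr : |R - r| ≤ r / 4 := by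
    have e1 : R - r = -(r ^ 3 * (m.q n ^ 2 / 2)) + r ^ 4 * (m.q n ^ 2 * m.l n) := by
      rw [hR, radiusPoly]; ring
    have e2 : r ^ 3 * (m.q n ^ 2 / 2) ≤ r / 8 := by
      calc r ^ 3 * (m.q n ^ 2 / 2) ≤ r ^ 3 * (k1 / 2) := by gcongr
        _ = r * (k1 / 2 * r ^ 2) := by ring
        _ ≤ r * (1 / 8) := by gcongr
        _ = _ := by ring
    have e3 : |r ^ 4 * (m.q n ^ 2 * m.l n)| ≤ r / 8 := by
      calc |r ^ 4 * (m.q n ^ 2 * m.l n)| ≤ r ^ 4 * k :=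
            abs_mul_le_of_le (abs_of_pos (by positivity)).le hqln
        _ = r * (k * r ^ 3) := by ring
        _ ≤ r * (1 / 8) := by gcongr
        _ = _ := by ring
    have e4 : 0 ≤ r ^ 3 * (m.q n ^ 2 / 2) := by positivity
    rw [e1, abs_le]
    rw [abs_le] at e3
    constructor <;> linarith [e3.1, e3.2]
  rw [abs_le] at hRr
  have hpR := h2 r h0 s2 n hn
  simp only [← hR] at hpR
  rw [abs_le] at hpR
  have hs3 : 12 * k * (2 * r) ^ 3 ≤ 1 := by linarith [s3]
  refine ⟨by linarith, by linarith, ?_, ?_⟩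
  · intro ϱ hϱ hlt
    have hϱr : ϱ < 2 * r := by linarith
    rw [mem_disk_iff hϱ hn]
    have hs := h1 ϱ hϱ (hϱr.trans s1) n hn
    simp only at hs
    rw [abs_le] at hs
    have hs' := mul_le_mul_of_nonneg_left hs.2 (sq_nonneg ϱ)
    have hmono := half_mul_le_sub (Q := m.q n ^ 2) hq0 hqln hϱ
      (by linarith) (by linarith : R ≤ 2 * r) hs3
    have h6 : ϱ ^ 6 ≤ 64 * r ^ 6 := by
      calc ϱ ^ 6 ≤ (2 * r) ^ 6 := by gcongr
        _ = _ := by ring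
    have hCR : C * r ^ 5 * (r / 2) ≤ (R - ϱ) * (R + ϱ) :=
      mul_le_mul (by linarith) (by linarith) (by linarith) (by linarith)
    have h6' : C1 * ϱ ^ 6 ≤ C1 * (64 * r ^ 6) := by gcongr
    have hC' : C * r ^ 5 * (r / 2) = 2 * (64 * C1 + C2 + 1) * r ^ 6 := by rw [hC]; ring
    have h6pos : 0 < r ^ 6 := by positivity
    nlinarith [hpR.2]
  · intro ϱ hϱ hmem
    by_contra hlt
    rw [not_lt] at hlt
    rw [mem_disk_iff hϱ hn] at hmem
    have hϱr : ϱ < r := by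
      refine lt_of_pow_lt_pow_left₀ 2 h0.le (lt_of_le_of_lt ?_ hmem)
      have := mul_nonneg (sq_nonneg ϱ) (mul_self_nonneg (m.slope (ϱ, n)))
      linarith
    have hs := h1 ϱ hϱ (by linarith) n hn
    simp only at hs
    rw [abs_le] at hs
    have hs' := mul_le_mul_of_nonneg_left hs.1 (sq_nonneg ϱ)
    have hRpos : 0 < R := by linarith
    have hmono := half_mul_le_sub (Q := m.q n ^ 2) hq0 hqln hRpos
      (by linarith) (by linarith : ϱ ≤ 2 * r) hs3
    have h6 : ϱ ^ 6 ≤ r ^ 6 := by gcongr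
    have hCR : C * r ^ 5 * (r / 2) ≤ (ϱ - R) * (ϱ + R) :=
      mul_le_mul (by linarith) (by linarith) (by linarith) (by linarith)
    have h6' : C1 * ϱ ^ 6 ≤ C1 * (r ^ 6) := by gcongr
    have hC' : C * r ^ 5 * (r / 2) = 2 * (64 * C1 + C2 + 1) * r ^ 6 := by rw [hC]; ring
    have h6pos : 0 < r ^ 6 := by positivity
    nlinarith [hpR.1, mul_pos hC1 h6pos, mul_pos hC2 h6pos]

end QuadricCoeffs

/-! ### Radial and angular integration over the projected neighbourhood. -/

/-- The integrand `F` on the plane has, in polar coordinates, an expansion with coefficients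
`g₀, …, g₃` that alternate in parity. -/
structure PolarExpansion (F g₀ g₁ g₂ g₃ : ℝ × ℝ → ℝ) : Prop where
  measurable : Measurable F
  continuous_zero : Continuous g₀
  continuous_one : Continuous g₁
  continuous_two : Continuous g₂
  continuous_three : Continuous g₃
  even_zero : ∀ n, g₀ (-n) = g₀ n
  odd_one : ∀ n, g₁ (-n) = -g₁ n
  odd_three : ∀ n, g₃ (-n) = -g₃ n
  approx : Approx 4 (fun p => F (p.1 * p.2.1, p.1 * p.2.2))
    fun p => g₀ p.2 + p.1 * g₁ p.2 + p.1 ^ 2 * g₂ p.2 + p.1 ^ 3 * g₃ p.2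

theorem integral_cubic_mul (c₀ c₁ c₂ c₃ R : ℝ) :
    ∫ x in (0 : ℝ)..R, x * (c₀ + x * c₁ + x ^ 2 * c₂ + x ^ 3 * c₃)
      = c₀ * R ^ 2 / 2 + c₁ * R ^ 3 / 3 + c₂ * R ^ 4 / 4 + c₃ * R ^ 5 / 5 := by
  have h : ∀ x ∈ uIcc 0 R, HasDerivAt
      (fun x : ℝ => c₀ * x ^ 2 / 2 + c₁ * x ^ 3 / 3 + c₂ * x ^ 4 / 4 + c₃ * x ^ 5 / 5)
      (x * (c₀ + x * c₁ + x ^ 2 * c₂ + x ^ 3 * c₃)) x := by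
    intro x _
    have := (((((hasDerivAt_pow 2 x).const_mul c₀).div_const 2).add
      (((hasDerivAt_pow 3 x).const_mul c₁).div_const 3)).add
      (((hasDerivAt_pow 4 x).const_mul c₂).div_const 4)).add
      (((hasDerivAt_pow 5 x).const_mul c₃).div_const 5)
    refine this.congr_deriv ?_
    push_cast
    ring
  rw [intervalIntegral.integral_eq_sub_of_hasDerivAt h
    (Continuous.intervalIntegrable (by fun_prop) _ _)]
  ring

namespace QuadricCoeffs

variable {m : QuadricCoeffs} {F g₀ g₁ g₂ g₃ : ℝ × ℝ → ℝ}

theorem measurable_graph : Measurable m.graph := by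
  have hq : Measurable m.q := m.continuous_q.measurable
  have hl : Measurable m.l := m.continuous_l.measurable
  have hd : Measurable m.disc := by unfold disc; fun_prop
  unfold graph
  fun_prop

theorem measurableSet_disk (r : ℝ) : MeasurableSet (m.disk r) := by
  have := m.measurable_graph
  exact measurableSet_lt (by fun_prop) measurable_const

/-- The radial slice of the disk in the direction `p.2`. -/
def slice (m : QuadricCoeffs) (p : ℝ × (ℝ × ℝ)) : Set ℝ :=
  {ϱ | 0 < ϱ ∧ (ϱ * p.2.1, ϱ * p.2.2) ∈ m.disk p.1}

theorem measurableSet_slice (p : ℝ × (ℝ × ℝ)) : MeasurableSet (m.slice p) := by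
  refine measurableSet_Ioi.inter ?_
  exact (show Measurable fun ϱ : ℝ => (ϱ * p.2.1, ϱ * p.2.2) by fun_prop)
    (measurableSet_disk (m := m) p.1)

theorem slice_integral_approx_polynomial (hF : PolarExpansion F g₀ g₁ g₂ g₃) :
    Approx 6 (fun p => ∫ ϱ in m.slice p, ϱ * F (ϱ * p.2.1, ϱ * p.2.2))
      fun p => ∫ ϱ in (0 : ℝ)..m.radiusPoly p,
        ϱ * (g₀ p.2 + ϱ * g₁ p.2 + ϱ ^ 2 * g₂ p.2 + ϱ ^ 3 * g₃ p.2) := by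
  obtain ⟨C, hC, δ, hδ, hsand⟩ := m.exists_disk_sandwich
  obtain ⟨C1, hC1, δ1, hδ1, happ⟩ := hF.approx.exists_bound
  obtain ⟨k0, hk0, b0⟩ := exists_bound_unitCircle hF.continuous_zero
  obtain ⟨k1, hk1, b1⟩ := exists_bound_unitCircle hF.continuous_one
  obtain ⟨k2, hk2, b2⟩ := exists_bound_unitCircle hF.continuous_two
  obtain ⟨k3, hk3, b3⟩ := exists_bound_unitCircle hF.continuous_three
  set K := k0 + k1 + k2 + k3 with hK
  -- The integrand error C₁(2r)⁵ over a length at most 2r gives 64C₁r⁶; the uncertainty 2Cr⁵ of the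
  -- endpoint times the bound 2rK, counted twice, gives 8KCr⁶. Radii below 1/2 keep ϱ ≤ 1.
  refine IsBigO.of_bound (64 * C1 + 8 * K * C) (eventually_polarFilter.mpr
    ⟨min δ (min (δ1 / 2) (1 / 2)), by positivity, fun r hr0 hr n hn => ?_⟩)
  rw [lt_min_iff, lt_min_iff] at hr
  obtain ⟨hr1, hr2, hr3⟩ := hr
  obtain ⟨ha, hb, hin, hout⟩ := hsand r hr0 hr1 n hn
  set R := m.radiusPoly (r, n)
  have hCr : 0 < C * r ^ 5 := by positivity
  have hF' : Measurable fun ϱ : ℝ => ϱ * F (ϱ * n.1, ϱ * n.2) :=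
    measurable_id.mul (hF.measurable.comp (by fun_prop))
  have hmain := abs_setIntegral_sub_le (f := fun ϱ => ϱ * F (ϱ * n.1, ϱ * n.2))
    (P := fun ϱ => ϱ * (g₀ n + ϱ * g₁ n + ϱ ^ 2 * g₂ n + ϱ ^ 3 * g₃ n))
    (A := m.slice (r, n)) (a := R - C * r ^ 5) (b := R + C * r ^ 5) (R := R)
    (ε := C1 * (2 * r) ^ 5) (K := 2 * r * K) hF' (by fun_prop) (measurableSet_slice _) ha
    (by linarith) (by linarith) (fun ϱ h => ⟨h.1, hout ϱ h.1 h.2⟩)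
    (fun ϱ h => ⟨h.1, hin ϱ h.1 h.2⟩) ?_ ?_
  · rw [Real.norm_eq_abs, Real.norm_of_nonneg (by positivity)]
    refine hmain.trans ?_
    have e1 : C1 * (2 * r) ^ 5 * (R + C * r ^ 5) ≤ C1 * (2 * r) ^ 5 * (2 * r) := by gcongr
    calc _ ≤ C1 * (2 * r) ^ 5 * (2 * r) + 2 * (2 * r * K * ((R + C * r ^ 5) - (R - C * r ^ 5))) :=
          by gcongr
      _ = _ := by ring
  · intro ϱ hϱ
    have h := happ ϱ hϱ.1 (by linarith [hϱ.2]) n hn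
    simp only at h
    rw [← mul_sub]
    have hϱ0 : 0 < ϱ := hϱ.1
    have hϱ2 : ϱ ≤ 2 * r := by linarith [hϱ.2]
    calc _ ≤ ϱ * (C1 * ϱ ^ 4) := abs_mul_le_of_le (abs_of_pos hϱ.1).le h
      _ = C1 * ϱ ^ 5 := by ring
      _ ≤ _ := by gcongr
  · intro ϱ hϱ
    have hϱ1 : |ϱ| ≤ 1 := by
      rw [abs_le]; constructor <;> linarith [hϱ.1, hϱ.2]
    have hϱ2 : |ϱ| ≤ 2 * r := by
      rw [abs_le]; constructor <;> linarith [hϱ.1, hϱ.2]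
    refine abs_mul_le_of_le hϱ2 ?_
    have q0 := b0 n hn
    have q1 := abs_mul_le_of_le hϱ1 (b1 n hn)
    have q2 := abs_mul_le_of_le (x := ϱ ^ 2) (X := 1)
      (by rw [abs_pow]; exact pow_le_one₀ (abs_nonneg _) hϱ1) (b2 n hn)
    have q3 := abs_mul_le_of_le (x := ϱ ^ 3) (X := 1)
      (by rw [abs_pow]; exact pow_le_one₀ (abs_nonneg _) hϱ1) (b3 n hn)
    rw [abs_le] at *
    constructor <;> linarith [q0.1, q0.2, q1.1, q1.2, q2.1, q2.2, q3.1, q3.2]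

/-- The expansion of the radial integrals. -/
noncomputable def slicePoly (m : QuadricCoeffs) (g₀ g₁ g₂ g₃ : ℝ × ℝ → ℝ) (p : ℝ × (ℝ × ℝ)) : ℝ :=
  p.1 ^ 2 * (g₀ p.2 / 2) + p.1 ^ 3 * (g₁ p.2 / 3)
    + p.1 ^ 4 * (g₂ p.2 / 4 - g₀ p.2 * m.q p.2 ^ 2 / 2)
    + p.1 ^ 5 * (g₃ p.2 / 5 + g₀ p.2 * (m.q p.2 ^ 2 * m.l p.2) - g₁ p.2 * m.q p.2 ^ 2 / 2)

theorem slice_integral_approx (hF : PolarExpansion F g₀ g₁ g₂ g₃) :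
    Approx 6 (fun p => ∫ ϱ in m.slice p, ϱ * F (ϱ * p.2.1, ϱ * p.2.2))
      (m.slicePoly g₀ g₁ g₂ g₃) := by
  refine (slice_integral_approx_polynomial hF).trans ?_
  have c0 := hF.continuous_zero
  have c1 := hF.continuous_one
  have c2 := hF.continuous_two
  have c3 := hF.continuous_three
  refine Approx.of_eq (fun p => g₀ p.2 / 2 * m.shrink p ^ 2
    + g₁ p.2 / 3 * (3 * p.1 * m.shrink p ^ 2 - p.1 ^ 3 * m.shrink p ^ 3)
    + g₁ p.2 * (m.q p.2 ^ 2 * m.l p.2)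
    + g₂ p.2 / 4 * (-4 * m.shrink p + 6 * p.1 ^ 2 * m.shrink p ^ 2
      - 4 * p.1 ^ 4 * m.shrink p ^ 3 + p.1 ^ 6 * m.shrink p ^ 4)
    + p.1 * (g₃ p.2 / 5) * (-5 * m.shrink p + 10 * p.1 ^ 2 * m.shrink p ^ 2
      - 10 * p.1 ^ 4 * m.shrink p ^ 3 + 5 * p.1 ^ 6 * m.shrink p ^ 4 - p.1 ^ 8 * m.shrink p ^ 5))
    (by fun_prop) fun p => ?_
  rw [integral_cubic_mul, radiusPoly_eq, slicePoly]
  have : m.q p.2 ^ 2 = 2 * m.shrink p + 2 * p.1 * (m.q p.2 ^ 2 * m.l p.2) := by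
    unfold shrink; ring
  linear_combination (p.1 ^ 4 * g₀ p.2 / 2 + p.1 ^ 5 * g₁ p.2 / 2) * this

theorem cos_sin_mem_unitCircle (θ : ℝ) : (Real.cos θ, Real.sin θ) ∈ unitCircle :=
  Real.cos_sq_add_sin_sq θ

/-- Integration over the disk in polar coordinates. -/
theorem setIntegral_disk_eq {r M : ℝ} (hr : 0 < r) (hF : Measurable F)
    (hM : ∀ ϱ : ℝ, 0 < ϱ → ϱ < r → ∀ n ∈ unitCircle, |F (ϱ * n.1, ϱ * n.2)| ≤ M) :
    IntervalIntegrable (fun θ => ∫ ϱ in m.slice (r, (Real.cos θ, Real.sin θ)),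
      ϱ * F (ϱ * Real.cos θ, ϱ * Real.sin θ)) volume (-Real.pi) Real.pi ∧
    ∫ x in m.disk r, F x = ∫ θ in (-Real.pi)..Real.pi,
      ∫ ϱ in m.slice (r, (Real.cos θ, Real.sin θ)), ϱ * F (ϱ * Real.cos θ, ϱ * Real.sin θ) := by
  set H : ℝ × ℝ → ℝ := fun p =>
    p.1 * (m.disk r).indicator F (p.1 * Real.cos p.2, p.1 * Real.sin p.2) with hH
  have hHm : Measurable H :=
    measurable_fst.mul ((hF.indicator (measurableSet_disk r)).comp (by fun_prop))
  set T : Set (ℝ × ℝ) := Ioi (0 : ℝ) ×ˢ Ioo (-Real.pi) Real.pi with hT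
  have hTm : MeasurableSet T := measurableSet_Ioi.prod measurableSet_Ioo
  set E : Set (ℝ × ℝ) := Ioo (0 : ℝ) r ×ˢ Ioo (-Real.pi) Real.pi with hE
  have hEm : MeasurableSet E := measurableSet_Ioo.prod measurableSet_Ioo
  have hEi : IntegrableOn H E := by
    refine Measure.integrableOn_of_bounded (M := r * M) ?_ hHm.aestronglyMeasurable ?_
    · rw [hE, Measure.volume_eq_prod, Measure.prod_prod]
      simp [ENNReal.mul_eq_top]
    · filter_upwards [ae_restrict_mem hEm] with p hp
      refine abs_mul_le_of_le ?_ ?_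
      · rw [abs_of_pos hp.1.1]; exact hp.1.2.le
      · have := hM p.1 hp.1.1 hp.1.2 _ (cos_sin_mem_unitCircle p.2)
        classical
        rw [indicator_apply]
        split_ifs
        · exact this
        · simpa using (abs_nonneg _).trans this
  -- The planar distance is at most the spatial one, so slices lie in (0, r) and integrability on a
  -- bounded rectangle suffices.
  have hTi : IntegrableOn H T := by
    refine hEi.of_forall_sdiff_eq_zero hTm fun p hp => ?_
    have hp0 : 0 < p.1 := hp.1.1
    have hpr : r ≤ p.1 := by
      by_contra hlt
      exact hp.2 ⟨⟨hp0, not_le.mp hlt⟩, hp.1.2⟩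
    have : (p.1 * Real.cos p.2, p.1 * Real.sin p.2) ∉ m.disk r := by
      intro hmem
      rw [mem_disk_iff (n := (Real.cos p.2, Real.sin p.2)) hp0 (cos_sin_mem_unitCircle p.2)] at hmem
      have h1 := mul_nonneg (sq_nonneg p.1) (mul_self_nonneg (m.slope (p.1, Real.cos p.2, Real.sin p.2)))
      have h2 : r ^ 2 ≤ p.1 ^ 2 := by gcongr
      linarith
    rw [hH]
    simp only [indicator_of_notMem this, mul_zero]
  have hslice : ∀ θ, ∫ ϱ in Ioi (0 : ℝ), H (ϱ, θ)
      = ∫ ϱ in m.slice (r, (Real.cos θ, Real.sin θ)), ϱ * F (ϱ * Real.cos θ, ϱ * Real.sin θ) := by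
    intro θ
    have hms := measurableSet_slice (m := m) (r, (Real.cos θ, Real.sin θ))
    rw [← integral_indicator measurableSet_Ioi, ← integral_indicator hms]
    congr 1
    funext ϱ
    by_cases h0 : 0 < ϱ
    · by_cases h1 : (ϱ * Real.cos θ, ϱ * Real.sin θ) ∈ m.disk r
      · rw [indicator_of_mem (show ϱ ∈ Ioi 0 from h0), indicator_of_mem (by exact ⟨h0, h1⟩), hH]
        simp only [indicator_of_mem h1]
      · rw [indicator_of_mem (show ϱ ∈ Ioi 0 from h0), indicator_of_notMem (fun h => h1 h.2), hH]
        simp only [indicator_of_notMem h1, mul_zero]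
    · rw [indicator_of_notMem (show ϱ ∉ Ioi 0 from h0), indicator_of_notMem (fun h => h0 h.1)]
  have hTi' : Integrable H ((volume.restrict (Ioi (0 : ℝ))).prod
      (volume.restrict (Ioo (-Real.pi) Real.pi))) := by
    rw [Measure.prod_restrict, ← Measure.volume_eq_prod]
    exact hTi
  have hpi : -Real.pi ≤ Real.pi := by linarith [Real.pi_pos]
  constructor
  · rw [intervalIntegrable_iff_integrableOn_Ioo_of_le hpi]
    simp only [← hslice]
    exact hTi'.integral_prod_right
  · rw [← integral_indicator (measurableSet_disk r), ← integral_comp_polarCoord_symm,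
      polarCoord_target, intervalIntegral.integral_of_le hpi, integral_Ioc_eq_integral_Ioo]
    simp only [← hslice]
    rw [← integral_prod_symm H hTi', Measure.prod_restrict, ← Measure.volume_eq_prod]
    rfl

/-- Antipodal directions cancel under the shift of the angle by π. -/
theorem integral_odd_direction {g : ℝ × ℝ → ℝ} (hg : Continuous g) (hodd : ∀ n, g (-n) = -g n) :
    ∫ θ in (-Real.pi)..Real.pi, g (Real.cos θ, Real.sin θ) = 0 := by
  have hc : Continuous fun θ : ℝ => g (Real.cos θ, Real.sin θ) := by fun_prop
  rw [← intervalIntegral.integral_add_adjacent_intervals (b := 0)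
    (hc.intervalIntegrable _ _) (hc.intervalIntegrable _ _)]
  have h := intervalIntegral.integral_comp_add_right (a := -Real.pi) (b := 0)
    (fun θ : ℝ => g (Real.cos θ, Real.sin θ)) Real.pi
  simp only [neg_add_cancel, zero_add, Real.cos_add_pi, Real.sin_add_pi] at h
  rw [← h, ← intervalIntegral.integral_add (hc.intervalIntegrable _ _)
    (Continuous.intervalIntegrable (by fun_prop) _ _)]
  refine intervalIntegral.integral_zero_ae (Eventually.of_forall fun θ _ => ?_)
  have := hodd (Real.cos θ, Real.sin θ)
  rw [Prod.neg_mk] at this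
  rw [this, add_neg_cancel]

theorem q_neg (n : ℝ × ℝ) : m.q (-n) = m.q n := by simp [q]

theorem l_neg (n : ℝ × ℝ) : m.l (-n) = -m.l n := by simp [l]; ring

/-- The coefficients of r³ and r⁵ are odd in the direction. Evenness of `g₀` is needed for the term
g₀q²l, which the r⁴ correction of the radius contributes to r⁵. -/
theorem integral_slicePoly (hF : PolarExpansion F g₀ g₁ g₂ g₃) (r : ℝ) :
    ∫ θ in (-Real.pi)..Real.pi, m.slicePoly g₀ g₁ g₂ g₃ (r, (Real.cos θ, Real.sin θ))
      = r ^ 2 * (∫ θ in (-Real.pi)..Real.pi, g₀ (Real.cos θ, Real.sin θ) / 2)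
        + r ^ 4 * ∫ θ in (-Real.pi)..Real.pi, (g₂ (Real.cos θ, Real.sin θ) / 4
          - g₀ (Real.cos θ, Real.sin θ) * m.q (Real.cos θ, Real.sin θ) ^ 2 / 2) := by
  have c0 := hF.continuous_zero
  have c1 := hF.continuous_one
  have c2 := hF.continuous_two
  have c3 := hF.continuous_three
  have o1 := integral_odd_direction (g := fun n => g₁ n / 3) (by fun_prop)
    (fun n => by rw [hF.odd_one]; ring)
  have o3 := integral_odd_direction (g := fun n => g₃ n / 5 + g₀ n * (m.q n ^ 2 * m.l n)
    - g₁ n * m.q n ^ 2 / 2) (by fun_prop)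
    (fun n => by rw [hF.odd_one, hF.odd_three, hF.even_zero, q_neg, l_neg]; ring)
  unfold slicePoly
  simp only
  rw [intervalIntegral.integral_add, intervalIntegral.integral_add, intervalIntegral.integral_add]
  · simp only [intervalIntegral.integral_const_mul]
    rw [o1, o3]
    ring
  all_goals exact Continuous.intervalIntegrable (by fun_prop) _ _

theorem setIntegral_disk_expansion (hF : PolarExpansion F g₀ g₁ g₂ g₃) :
    (fun r => (∫ x in m.disk r, F x) -
      (r ^ 2 * (∫ θ in (-Real.pi)..Real.pi, g₀ (Real.cos θ, Real.sin θ) / 2)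
        + r ^ 4 * ∫ θ in (-Real.pi)..Real.pi, (g₂ (Real.cos θ, Real.sin θ) / 4
          - g₀ (Real.cos θ, Real.sin θ) * m.q (Real.cos θ, Real.sin θ) ^ 2 / 2)))
      =O[𝓝[>] 0] fun r => r ^ 6 := by
  have c0 := hF.continuous_zero
  have c1 := hF.continuous_one
  have c2 := hF.continuous_two
  have c3 := hF.continuous_three
  obtain ⟨C, hC, δ, hδ, h⟩ := (slice_integral_approx (m := m) hF).exists_bound
  obtain ⟨M, hM⟩ := (hF.approx.isBigO_one (by fun_prop)).bound
  obtain ⟨δ', hδ', hM⟩ := eventually_polarFilter.mp hM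
  refine IsBigO.of_bound (C * |Real.pi - -Real.pi|) ?_
  filter_upwards [Ioo_mem_nhdsGT (lt_min hδ hδ')] with r ⟨hr0, hr⟩
  rw [lt_min_iff] at hr
  obtain ⟨hi, heq⟩ := setIntegral_disk_eq (m := m) (M := M) hr0 hF.measurable
    (fun ϱ h0 h1 n hn => by simpa using hM ϱ h0 (h1.trans hr.2) n hn)
  rw [← integral_slicePoly hF, heq, ← intervalIntegral.integral_sub hi
    (Continuous.intervalIntegrable (by unfold slicePoly; fun_prop) _ _)]
  refine (intervalIntegral.norm_integral_le_of_norm_le_const (C := C * r ^ 6) fun θ _ => ?_).trans ?_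
  · exact h r hr0 hr.1 _ (cos_sin_mem_unitCircle θ)
  · rw [Real.norm_of_nonneg (by positivity)]
    exact le_of_eq (by ring)

end QuadricCoeffs

/-! ### Angular integrals and quotients of expansions. -/

/-- The averages of cos², cos⁴, cos⁶ are 1/2, 3/8, 5/16, and the terms with a single factor sin have
an antiderivative in cos alone. -/
theorem integral_trig_polynomial (a b d e f g h : ℝ) :
    ∫ θ in (-Real.pi)..Real.pi, (a + b * Real.cos θ ^ 2 + d * Real.cos θ ^ 4 + e * Real.cos θ ^ 6
      + Real.sin θ * Real.cos θ * (f + g * Real.cos θ ^ 2 + h * Real.cos θ ^ 4))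
      = Real.pi * (2 * a + b + 3 / 4 * d + 5 / 8 * e) := by
  have hd : ∀ θ ∈ uIcc (-Real.pi) Real.pi, HasDerivAt (fun θ : ℝ =>
      (a + b / 2 + 3 / 8 * d + 5 / 16 * e) * θ
        + (Real.sin θ * Real.cos θ) * (b / 2 + 3 / 8 * d + 5 / 16 * e
          + (d / 4 + 5 / 24 * e) * Real.cos θ ^ 2 + e / 6 * Real.cos θ ^ 4)
        - (f / 2 * Real.cos θ ^ 2 + g / 4 * Real.cos θ ^ 4 + h / 6 * Real.cos θ ^ 6))
      (a + b * Real.cos θ ^ 2 + d * Real.cos θ ^ 4 + e * Real.cos θ ^ 6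
      + Real.sin θ * Real.cos θ * (f + g * Real.cos θ ^ 2 + h * Real.cos θ ^ 4)) θ := by
    intro θ _
    have hc := Real.hasDerivAt_cos θ
    have hs := Real.hasDerivAt_sin θ
    have := (((hasDerivAt_id θ).const_mul (a + b / 2 + 3 / 8 * d + 5 / 16 * e)).add
      ((hs.mul hc).mul ((((hc.pow 2).const_mul (d / 4 + 5 / 24 * e)).const_add
        (b / 2 + 3 / 8 * d + 5 / 16 * e)).add ((hc.pow 4).const_mul (e / 6))))).sub
      ((((hc.pow 2).const_mul (f / 2)).add ((hc.pow 4).const_mul (g / 4))).add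
        ((hc.pow 6).const_mul (h / 6)))
    refine this.congr_deriv ?_
    have hsq := Real.sin_sq θ
    simp only [Pi.mul_apply, Pi.pow_apply, Pi.add_apply]
    push_cast
    ring_nf
    simp only [hsq]
    ring
  rw [intervalIntegral.integral_eq_sub_of_hasDerivAt hd
    (Continuous.intervalIntegrable (by fun_prop) _ _)]
  simp only [Real.sin_neg, Real.cos_neg, Real.sin_pi, Real.cos_pi]
  ring

/-- The expansion of a quotient of functions with expansions in even powers. -/
theorem div_expansion {N D : ℝ → ℝ} {n₀ n₁ d₀ d₁ α β : ℝ} (hd₀ : 0 < d₀)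
    (hN : (fun r => N r - (r ^ 2 * n₀ + r ^ 4 * n₁)) =O[𝓝[>] 0] fun r => r ^ 6)
    (hD : (fun r => D r - (r ^ 2 * d₀ + r ^ 4 * d₁)) =O[𝓝[>] 0] fun r => r ^ 6)
    (h0 : α * d₀ = n₀) (h1 : β * d₀ + α * d₁ = n₁) :
    (fun r => N r / D r - (α + r ^ 2 * β)) =O[𝓝[>] 0] fun r => r ^ 4 := by
  -- The hypotheses on α and β cancel the r² and r⁴ coefficients; division by a denominator of order
  -- r² then costs two orders.
  have hnum : (fun r => N r - (α + r ^ 2 * β) * D r) =O[𝓝[>] 0] fun r => r ^ 6 := by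
    have hT := (isBigO_one_of_continuous (f := fun r => α + r ^ 2 * β) (by fun_prop) 0
      (Ioi 0)).mul hD
    simp only [one_mul] at hT
    refine ((hN.sub hT).sub (pow_mul_isBigO (f := fun _ => β * d₁) continuous_const 6 0
      (Ioi 0))).congr_left fun r => ?_
    rw [← h1, ← h0]
    ring
  have hDpos : ∀ᶠ r in 𝓝[>] (0 : ℝ), r ^ 2 * (d₀ / 2) ≤ D r := by
    obtain ⟨C, hC, hb⟩ := exists_bound_isBigO hD
    filter_upwards [hb, self_mem_nhdsWithin, eventually_pow_lt (c := d₀ / 4) (by positivity) C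
      four_ne_zero, eventually_pow_lt (c := d₀ / 4) (by positivity) |d₁| two_ne_zero]
      with r h2 hr h3 h4
    rw [Real.norm_eq_abs, abs_le] at h2
    have hr2 : 0 < r ^ 2 := by have : 0 < r := hr; positivity
    have h5 : -|d₁| ≤ d₁ := neg_abs_le d₁
    have h6 : C * r ^ 6 ≤ d₀ / 4 * r ^ 2 := by
      calc C * r ^ 6 = C * r ^ 4 * r ^ 2 := by ring
        _ ≤ _ := by gcongr
    have h7 : -(d₀ / 4 * r ^ 2) ≤ r ^ 4 * d₁ := by
      calc -(d₀ / 4 * r ^ 2) ≤ -(|d₁| * r ^ 2 * r ^ 2) := by gcongr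
        _ = r ^ 4 * -|d₁| := by ring
        _ ≤ _ := by gcongr
    linarith [h2.1]
  obtain ⟨C, hC, hb⟩ := exists_bound_isBigO hnum
  refine IsBigO.of_bound (C * (2 / d₀)) ?_
  filter_upwards [hb, hDpos, self_mem_nhdsWithin] with r h2 h3 hr
  have hr : 0 < r := hr
  have hDr : 0 < D r := lt_of_lt_of_le (by positivity) h3
  have : N r / D r - (α + r ^ 2 * β) = (N r - (α + r ^ 2 * β) * D r) / D r := by
    field_simp
  rw [this, norm_div, Real.norm_of_nonneg hDr.le, Real.norm_of_nonneg (pow_nonneg hr.le 4),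
    div_le_iff₀ hDr]
  calc _ ≤ C * r ^ 6 := h2
    _ = C * (2 / d₀) * r ^ 4 * (r ^ 2 * (d₀ / 2)) := by field_simp
    _ ≤ _ := by gcongr

/-! ### Expansion of the entries of the covariance matrix. -/

namespace QuadricCoeffs

variable {m : QuadricCoeffs}

theorem measurable_density_graph : Measurable fun x => m.density x (m.graph x) := by
  have hl : Measurable m.l := m.continuous_l.measurable
  have hg := m.measurable_graph
  unfold density
  fun_prop

theorem gradSq_neg (n : ℝ × ℝ) : m.gradSq (-n) = m.gradSq n := by simp [gradSq]

theorem gradCub_neg (n : ℝ × ℝ) : m.gradCub (-n) = -m.gradCub n := by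
  simp only [gradCub, q_neg, l_neg, gradSq_neg, Prod.fst_neg, Prod.snd_neg]
  ring

theorem polarExpansion_density :
    PolarExpansion (fun x => m.density x (m.graph x)) (fun _ => 1) (fun _ => 0)
      (fun n => m.gradSq n / 2) (fun n => m.gradCub n / 2) where
  measurable := measurable_density_graph
  continuous_zero := by fun_prop
  continuous_one := by fun_prop
  continuous_two := by fun_prop
  continuous_three := by fun_prop
  even_zero := fun _ => rfl
  odd_one := fun _ => by simp
  odd_three := fun n => by rw [gradCub_neg]; ring
  approx := (polarDensity_approx (m := m)).trans
    (Approx.of_eq (fun _ => 0) continuous_const fun p => by ring)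

/-- Because ‖x‖² = ϱ²(1 + slope²), this factor is common to all entries; it is multiplied by n_i
n_j, by n_i · slope, or by slope². -/
theorem inv_mul_polarDensity_approx :
    Approx 4 (fun p => (1 + m.slope p * m.slope p)⁻¹ * m.polarDensity p)
      fun p => 1 + p.1 ^ 2 * (m.gradSq p.2 / 2 - m.q p.2 ^ 2)
        + p.1 ^ 3 * (m.gradCub p.2 / 2 + 2 * (m.q p.2 ^ 2 * m.l p.2)) :=
  (inv_one_add_slope_sq_approx.mul polarDensity_approx (by fun_prop) (by fun_prop)).trans
    (Approx.of_eq (fun p => -(m.q p.2 ^ 2 - 2 * p.1 * (m.q p.2 ^ 2 * m.l p.2))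
      * (m.gradSq p.2 / 2 + p.1 * (m.gradCub p.2 / 2))) (by fun_prop) fun p => by ring)

theorem slope_mul_approx :
    Approx 4 (fun p => m.slope p * ((1 + m.slope p * m.slope p)⁻¹ * m.polarDensity p))
      fun p => -p.1 * m.q p.2 + p.1 ^ 2 * (m.q p.2 * m.l p.2)
        - p.1 ^ 3 * (m.q p.2 * m.l p.2 ^ 2 + m.m33 * m.q p.2 ^ 2
          + m.q p.2 * (m.gradSq p.2 / 2 - m.q p.2 ^ 2)) := by
  refine (slope_approx_four.mul inv_mul_polarDensity_approx (by fun_prop) (by fun_prop)).trans ?_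
  let D3 : ℝ × (ℝ × ℝ) → ℝ := fun p => m.gradCub p.2 / 2 + 2 * (m.q p.2 ^ 2 * m.l p.2)
  let D2 : ℝ × (ℝ × ℝ) → ℝ := fun p => m.gradSq p.2 / 2 - m.q p.2 ^ 2
  let T3 : ℝ × (ℝ × ℝ) → ℝ := fun p => m.q p.2 * m.l p.2 ^ 2 + m.m33 * m.q p.2 ^ 2
  exact Approx.of_eq (fun p => -m.q p.2 * D3 p
      + m.q p.2 * m.l p.2 * (D2 p + p.1 * D3 p) - T3 p * (p.1 * D2 p + p.1 ^ 2 * D3 p))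
    (by fun_prop) fun p => by simp only [slopePoly, D2, D3, T3]; ring

theorem slope_sq_mul_approx :
    Approx 4 (fun p => m.slope p * m.slope p
      * ((1 + m.slope p * m.slope p)⁻¹ * m.polarDensity p))
      fun p => p.1 ^ 2 * m.q p.2 ^ 2 - 2 * p.1 ^ 3 * (m.q p.2 ^ 2 * m.l p.2) := by
  refine (slope_sq_approx.mul inv_mul_polarDensity_approx (by fun_prop) (by fun_prop)).trans ?_
  exact Approx.of_eq (fun p => (m.q p.2 ^ 2 - 2 * p.1 * (m.q p.2 ^ 2 * m.l p.2))
      * ((m.gradSq p.2 / 2 - m.q p.2 ^ 2)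
        + p.1 * (m.gradCub p.2 / 2 + 2 * (m.q p.2 ^ 2 * m.l p.2))))
    (by fun_prop) fun p => by ring

theorem eventually_graph_eq : ∀ᶠ p in polarFilter, 0 < p.1 ∧
    m.graph (p.1 * p.2.1, p.1 * p.2.2) = p.1 * m.slope p ∧
    (p.1 * p.2.1) ^ 2 + (p.1 * p.2.2) ^ 2 + m.graph (p.1 * p.2.1, p.1 * p.2.2) ^ 2
      = p.1 ^ 2 * (1 + m.slope p * m.slope p) := by
  filter_upwards [eventually_lt_rad (m := m)] with p ⟨h0, hn, _⟩
  have hs : m.graph (p.1 * p.2.1, p.1 * p.2.2) = p.1 * m.slope p := by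
    rw [slope]; field_simp
  have hn : p.2.1 ^ 2 + p.2.2 ^ 2 = 1 := hn
  refine ⟨h0, hs, ?_⟩
  rw [hs]
  linear_combination p.1 ^ 2 * hn

theorem polarExpansion_planar {φ : ℝ × ℝ → ℝ} (hφ : Continuous φ)
    (hom : ∀ (c : ℝ) n, φ (c * n.1, c * n.2) = c ^ 2 * φ n) :
    PolarExpansion (fun x => φ x / (x.1 ^ 2 + x.2 ^ 2 + m.graph x ^ 2) * m.density x (m.graph x))
      φ (fun _ => 0) (fun n => φ n * (m.gradSq n / 2 - m.q n ^ 2))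
      (fun n => φ n * (m.gradCub n / 2 + 2 * (m.q n ^ 2 * m.l n))) := by
  have heven : ∀ n, φ (-n) = φ n := fun n => by
    have := hom (-1) n
    simp only [neg_mul, one_mul, neg_sq, one_pow] at this
    exact this
  refine ⟨?_, hφ, by fun_prop, by fun_prop, by fun_prop, heven, fun _ => by simp, fun n => ?_, ?_⟩
  · have h1 := m.measurable_graph
    have h2 := m.measurable_density_graph
    have h3 := hφ.measurable
    fun_prop
  · rw [heven, gradCub_neg, l_neg, q_neg]; ring
  · have h1 := (inv_mul_polarDensity_approx (m := m)).const_mul (f' := fun p => φ p.2)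
      (by fun_prop)
    refine (h1.trans (Approx.of_eq (fun _ => 0) continuous_const fun p => by ring)).congr_left ?_
    filter_upwards [eventually_graph_eq (m := m)] with p ⟨h0, hs, hn⟩
    have : 0 < 1 + m.slope p * m.slope p := by nlinarith [mul_self_nonneg (m.slope p)]
    rw [hn, hom, polarDensity]
    field_simp

theorem polarExpansion_mixed {ψ : ℝ × ℝ → ℝ} (hψ : Continuous ψ)
    (hom : ∀ (c : ℝ) n, ψ (c * n.1, c * n.2) = c * ψ n) :
    PolarExpansion
      (fun x => ψ x * m.graph x / (x.1 ^ 2 + x.2 ^ 2 + m.graph x ^ 2) * m.density x (m.graph x))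
      (fun _ => 0) (fun n => -(ψ n * m.q n)) (fun n => ψ n * (m.q n * m.l n))
      (fun n => -(ψ n * (m.q n * m.l n ^ 2 + m.m33 * m.q n ^ 2
        + m.q n * (m.gradSq n / 2 - m.q n ^ 2)))) := by
  have hodd : ∀ n, ψ (-n) = -ψ n := fun n => by
    have := hom (-1) n
    simp only [neg_mul, one_mul] at this
    exact this
  refine ⟨?_, by fun_prop, by fun_prop, by fun_prop, by fun_prop, fun _ => rfl, fun n => ?_,
    fun n => ?_, ?_⟩
  · have h1 := m.measurable_graph
    have h2 := m.measurable_density_graph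
    have h3 := hψ.measurable
    fun_prop
  · rw [hodd, q_neg]; ring
  · rw [hodd, gradSq_neg, l_neg, q_neg]; ring
  · refine (((slope_mul_approx (m := m)).const_mul (f' := fun p => ψ p.2) (by fun_prop)).trans
      (Approx.of_eq (fun _ => 0) continuous_const fun p => by ring)).congr_left ?_
    filter_upwards [eventually_graph_eq (m := m)] with p ⟨h0, hs, hn⟩
    have : 0 < 1 + m.slope p * m.slope p := by nlinarith [mul_self_nonneg (m.slope p)]
    rw [hn, hom, polarDensity, hs]
    field_simp

theorem polarExpansion_normal :
    PolarExpansion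
      (fun x => m.graph x ^ 2 / (x.1 ^ 2 + x.2 ^ 2 + m.graph x ^ 2) * m.density x (m.graph x))
      (fun _ => 0) (fun _ => 0) (fun n => m.q n ^ 2) (fun n => -2 * (m.q n ^ 2 * m.l n)) := by
  refine ⟨?_, by fun_prop, by fun_prop, by fun_prop, by fun_prop, fun _ => rfl, fun n => by simp,
    fun n => ?_, ?_⟩
  · have h1 := m.measurable_graph
    have h2 := m.measurable_density_graph
    fun_prop
  · rw [l_neg, q_neg]; ring
  · refine ((slope_sq_mul_approx (m := m)).trans
      (Approx.of_eq (fun _ => 0) continuous_const fun p => by ring)).congr_left ?_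
    filter_upwards [eventually_graph_eq (m := m)] with p ⟨h0, hs, hn⟩
    have : 0 < 1 + m.slope p * m.slope p := by nlinarith [mul_self_nonneg (m.slope p)]
    rw [hn, polarDensity, hs]
    field_simp

/-- Replacing sin² by 1 - cos² brings the angular integrands to the shape of
`integral_trig_polynomial`, so each expansion amounts to a list of coefficients. -/
theorem disk_integral_of_coeffs {F g₀ g₁ g₂ g₃ : ℝ × ℝ → ℝ}
    (hF : PolarExpansion F g₀ g₁ g₂ g₃) {a' b' f' a b d e f g h : ℝ}
    (h0 : ∀ θ : ℝ, g₀ (Real.cos θ, Real.sin θ) / 2 = a' + b' * Real.cos θ ^ 2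
        + Real.sin θ * Real.cos θ * f')
    (h2 : ∀ θ : ℝ, g₂ (Real.cos θ, Real.sin θ) / 4
          - g₀ (Real.cos θ, Real.sin θ) * m.q (Real.cos θ, Real.sin θ) ^ 2 / 2
        = a + b * Real.cos θ ^ 2 + d * Real.cos θ ^ 4 + e * Real.cos θ ^ 6
          + Real.sin θ * Real.cos θ * (f + g * Real.cos θ ^ 2 + h * Real.cos θ ^ 4)) :
    (fun r => (∫ x in m.disk r, F x) - (r ^ 2 * (Real.pi * (2 * a' + b'))
      + r ^ 4 * (Real.pi * (2 * a + b + 3 / 4 * d + 5 / 8 * e)))) =O[𝓝[>] 0] fun r => r ^ 6 := by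
  have hE := setIntegral_disk_expansion (m := m) hF
  have e0 := integral_trig_polynomial a' b' 0 0 f' 0 0
  simp only [zero_mul, mul_zero, add_zero] at e0
  simpa only [h0, h2, integral_trig_polynomial, e0] using hE

/-- The r⁴ term balances the stretching of area, gradSq/8, against the loss q²/2 from the smaller
planar radius; it equals π(κ₁ - κ₂)²/32. -/
theorem integral_density_expansion :
    (fun r => (∫ x in m.disk r, m.density x (m.graph x))
      - (r ^ 2 * Real.pi + r ^ 4 * (Real.pi * ((m.m11 - m.m22) ^ 2 / 8))))
      =O[𝓝[>] 0] fun r => r ^ 6 := by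
  refine (disk_integral_of_coeffs (m := m) (polarExpansion_density (m := m)) (a' := 1 / 2)
    (b' := 0) (f' := 0) (a := 0) (b := (m.m11 ^ 2 - m.m22 ^ 2) / 2 - m.m22 * (m.m11 - m.m22))
    (d := -(m.m11 - m.m22) ^ 2 / 2) (e := 0) (f := 0) (g := 0) (h := 0) (fun θ => by ring)
    (fun θ => ?_)).congr_left fun r => ?_
  · simp only [gradSq, q, Real.sin_sq]; ring
  · ring

/-- The entries of the integrand of the covariance, in the tangent plane. -/
noncomputable def covIntegrand (m : QuadricCoeffs) (i j : Fin 3) (x : ℝ × ℝ) : ℝ :=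
  (!₂[x.1, x.2, m.graph x] : E3) i * (!₂[x.1, x.2, m.graph x] : E3) j
    / ‖(!₂[x.1, x.2, m.graph x] : E3)‖ ^ 2 * m.density x (m.graph x)

theorem covIntegrand_comm (i j : Fin 3) : m.covIntegrand i j = m.covIntegrand j i := by
  funext x
  rw [covIntegrand, covIntegrand, mul_comm ((!₂[x.1, x.2, m.graph x] : E3) i)]

theorem integral_planar_expansion {φ : ℝ × ℝ → ℝ} (hφ : Continuous φ)
    (hom : ∀ (c : ℝ) n, φ (c * n.1, c * n.2) = c ^ 2 * φ n) {a b f : ℝ}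
    (h : ∀ θ, φ (Real.cos θ, Real.sin θ)
      = a + b * Real.cos θ ^ 2 + Real.sin θ * Real.cos θ * f) :
    (fun r => (∫ x in m.disk r,
        φ x / (x.1 ^ 2 + x.2 ^ 2 + m.graph x ^ 2) * m.density x (m.graph x))
      - (r ^ 2 * (Real.pi * (a + b / 2)) + r ^ 4 * (Real.pi / 32 * (
        a * (-m.m11 ^ 2 * 2 - m.m22 ^ 2 * 2 - 12 * m.m11 * m.m22)
        + b * (-3 * m.m11 ^ 2 - 6 * m.m11 * m.m22 + m.m22 ^ 2))))) =O[𝓝[>] 0] fun r => r ^ 6 := by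
  -- A0, A1, A2 are the coefficients of gradSq/8 - 3q²/4 as a polynomial in cos².
  set A0 := -m.m22 ^ 2 / 4 with hA0
  set A1 := ((m.m11 ^ 2 - m.m22 ^ 2) - 3 * m.m22 * (m.m11 - m.m22)) / 2 with hA1
  set A2 := -3 * (m.m11 - m.m22) ^ 2 / 4 with hA2
  refine (disk_integral_of_coeffs (m := m) (polarExpansion_planar (m := m) hφ hom) (a' := a / 2)
    (b' := b / 2) (f' := f / 2) (a := a * A0) (b := a * A1 + b * A0) (d := a * A2 + b * A1)
    (e := b * A2) (f := f * A0) (g := f * A1) (h := f * A2)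
    (fun θ => by rw [h]; ring) (fun θ => ?_)).congr_left fun r => ?_
  · rw [h]; simp only [gradSq, q, Real.sin_sq, hA0, hA1, hA2]; ring
  · rw [hA0, hA1, hA2]; ring

/-- The coefficients are arranged as αd₀ and βd₀ + αd₁, with d₀ and d₁ those of the area, so that α
and β can be read off by `div_expansion`. -/
theorem integral_covariance_expansion (i j : Fin 3) :
    (fun r => (∫ x in m.disk r, m.covIntegrand i j x)
      - (r ^ 2 * ((Matrix.diagonal ![1 / 2, 1 / 2, 0] : Matrix (Fin 3) (Fin 3) ℝ) i j * Real.pi)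
        + r ^ 4 * (covCoeff m.m11 m.m22 m.m13 m.m23 i j * Real.pi
          + (Matrix.diagonal ![1 / 2, 1 / 2, 0] : Matrix (Fin 3) (Fin 3) ℝ) i j
            * (Real.pi * ((m.m11 - m.m22) ^ 2 / 8)))))
      =O[𝓝[>] 0] fun r => r ^ 6 := by
  have hcov : ∀ i j : Fin 3, m.covIntegrand i j = fun x =>
      (!₂[x.1, x.2, m.graph x] : E3) i * (!₂[x.1, x.2, m.graph x] : E3) j
        / (x.1 ^ 2 + x.2 ^ 2 + m.graph x ^ 2) * m.density x (m.graph x) := by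
    intro i j
    funext x
    rw [covIntegrand, norm_sq_fin_three]
    rfl
  have h00 := integral_planar_expansion (m := m) (φ := fun n => n.1 * n.1) (a := 0) (b := 1)
    (f := 0) (by fun_prop) (fun c n => by ring) (fun θ => by ring)
  have h01 := integral_planar_expansion (m := m) (φ := fun n => n.1 * n.2) (a := 0) (b := 0)
    (f := 1) (by fun_prop) (fun c n => by ring) (fun θ => by ring)
  have h11 := integral_planar_expansion (m := m) (φ := fun n => n.2 * n.2) (a := 1) (b := -1)
    (f := 0) (by fun_prop) (fun c n => by ring)
    (fun θ => by simp only [← pow_two, Real.sin_sq]; ring)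
  have h02 := disk_integral_of_coeffs (m := m) (polarExpansion_mixed (m := m) (ψ := fun n => n.1)
    (by fun_prop) (fun c n => rfl)) (a' := 0) (b' := 0) (f' := 0) (a := 0)
    (b := m.m13 * m.m22 / 4) (d := m.m13 * (m.m11 - m.m22) / 4) (e := 0) (f := m.m23 * m.m22 / 4)
    (g := m.m23 * (m.m11 - m.m22) / 4) (h := 0) (fun θ => by ring)
    (fun θ => by simp only [q, l, Real.sin_sq]; ring)
  have h12 := disk_integral_of_coeffs (m := m) (polarExpansion_mixed (m := m) (ψ := fun n => n.2)
    (by fun_prop) (fun c n => rfl)) (a' := 0) (b' := 0) (f' := 0) (a := m.m23 * m.m22 / 4)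
    (b := m.m23 * (m.m11 - 2 * m.m22) / 4) (d := -m.m23 * (m.m11 - m.m22) / 4) (e := 0)
    (f := m.m13 * m.m22 / 4) (g := m.m13 * (m.m11 - m.m22) / 4) (h := 0) (fun θ => by ring)
    (fun θ => by
      have hs := Real.sin_sq θ
      simp only [q, l]
      linear_combination (m.m13 * m.m22 * Real.sin θ * Real.cos θ / 4
        + m.m23 * (m.m11 * Real.cos θ ^ 2 + m.m22 * Real.sin θ ^ 2) / 4
        + m.m23 * m.m22 * (1 - Real.cos θ ^ 2) / 4) * hs)
  have h22 := disk_integral_of_coeffs (m := m) (polarExpansion_normal (m := m)) (a' := 0)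
    (b' := 0) (f' := 0) (a := m.m22 ^ 2 / 4) (b := m.m22 * (m.m11 - m.m22) / 2)
    (d := (m.m11 - m.m22) ^ 2 / 4) (e := 0) (f := 0) (g := 0) (h := 0) (fun θ => by ring)
    (fun θ => by simp only [q, Real.sin_sq]; ring)
  have sym : ∀ i j : Fin 3, covCoeff m.m11 m.m22 m.m13 m.m23 i j
      = covCoeff m.m11 m.m22 m.m13 m.m23 j i := by
    intro i j; fin_cases i <;> fin_cases j <;> rfl
  wlog hij : i ≤ j generalizing i j
  · have := this j i (le_of_not_ge hij)
    rw [covIntegrand_comm, sym, ← Matrix.diagonal_transpose, Matrix.transpose_apply]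
    exact this
  rw [hcov]
  fin_cases i <;> fin_cases j
  · refine h00.congr_left fun r => ?_
    simp [covCoeff]
    ring
  · refine h01.congr_left fun r => ?_
    simp [covCoeff]
  · refine h02.congr_left fun r => ?_
    simp [covCoeff]
    left; ring
  · exact absurd hij (by decide)
  · refine h11.congr_left fun r => ?_
    simp [covCoeff]
    ring
  · refine h12.congr_left fun r => ?_
    simp [covCoeff]
    left; ring
  · exact absurd hij (by decide)
  · exact absurd hij (by decide)
  · refine h22.congr_left fun r => ?_
    simp [covCoeff, pow_two]
    left; ring


theorem localDirectionCovariance_expansion {U : Set (ℝ × ℝ)} {X : ℝ × ℝ → E3}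
    (h : IsLocalParametrization m.surface 0 U X) (i j : Fin 3) :
    (fun r => localDirectionCovariance U X 0 r i j
      - leadingMatrix (covCoeff m.m11 m.m22 m.m13 m.m23) r i j) =O[𝓝[>] 0] fun r => r ^ 4 := by
  have hdiv := div_expansion Real.pi_pos (integral_covariance_expansion (m := m) i j)
    (integral_density_expansion (m := m)) rfl rfl
  obtain ⟨δ, hδ, hcov⟩ := h.covers
  refine hdiv.congr' ?_ EventuallyEq.rfl
  filter_upwards [Ioo_mem_nhdsGT (lt_min m.rad_pos hδ)] with r ⟨h0, hr⟩
  rw [lt_min_iff] at hr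
  have hcov' : m.surface ∩ Metric.ball 0 r ⊆ X '' U :=
    (inter_subset_inter_right _ (Metric.ball_subset_ball hr.2.le)).trans hcov
  have hN := setIntegral_searchRegion h h0 hr.1.le hcov' fun v => v i * v j / ‖v‖ ^ 2
  have hD := setIntegral_searchRegion h h0 hr.1.le hcov' fun _ => 1
  simp only [one_mul] at hD
  simp only [localDirectionCovariance, Matrix.of_apply, sub_zero]
  rw [hN, hD]
  rfl

theorem q_cos_sin_eq (θ : ℝ) : -2 * m.q (Real.cos θ, Real.sin θ)
    = -2 * m.m11 * Real.cos θ ^ 2 + -2 * m.m22 * Real.sin θ ^ 2 := by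
  simp only [q]; ring

theorem isGreatest_normalCurvature :
    IsGreatest {k | ∃ θ, HasNormalCurvature m.surface θ k} (max (-2 * m.m11) (-2 * m.m22)) := by
  simp only [hasNormalCurvature_iff, q_cos_sin_eq]
  constructor
  · rcases max_choice (-2 * m.m11) (-2 * m.m22) with h | h
    · exact ⟨0, by rw [h]; simp⟩
    · exact ⟨Real.pi / 2, by rw [h]; simp⟩
  · rintro k ⟨θ, rfl⟩
    have h1 := mul_le_mul_of_nonneg_right (le_max_left (-2 * m.m11) (-2 * m.m22))
      (sq_nonneg (Real.cos θ))
    have h2 := mul_le_mul_of_nonneg_right (le_max_right (-2 * m.m11) (-2 * m.m22))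
      (sq_nonneg (Real.sin θ))
    refine (add_le_add h1 h2).trans_eq ?_
    rw [← mul_add, Real.cos_sq_add_sin_sq, mul_one]

theorem isLeast_normalCurvature :
    IsLeast {k | ∃ θ, HasNormalCurvature m.surface θ k} (min (-2 * m.m11) (-2 * m.m22)) := by
  simp only [hasNormalCurvature_iff, q_cos_sin_eq]
  constructor
  · rcases min_choice (-2 * m.m11) (-2 * m.m22) with h | h
    · exact ⟨0, by rw [h]; simp⟩
    · exact ⟨Real.pi / 2, by rw [h]; simp⟩
  · rintro k ⟨θ, rfl⟩
    have h1 := mul_le_mul_of_nonneg_right (min_le_left (-2 * m.m11) (-2 * m.m22))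
      (sq_nonneg (Real.cos θ))
    have h2 := mul_le_mul_of_nonneg_right (min_le_right (-2 * m.m11) (-2 * m.m22))
      (sq_nonneg (Real.sin θ))
    refine le_trans (le_of_eq ?_) (add_le_add h1 h2)
    rw [← mul_add, Real.cos_sq_add_sin_sq, mul_one]

end QuadricCoeffs

/-! ### Symmetry of both matrices, and the final assembly. -/

theorem localDirectionCovariance_isHermitian (U : Set (ℝ × ℝ)) (X : ℝ × ℝ → E3) (v : E3) (r : ℝ) :
    (localDirectionCovariance U X v r).IsHermitian := by
  ext i j
  simp only [Matrix.conjTranspose_apply, localDirectionCovariance, Matrix.of_apply, star_trivial,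
    mul_comm ((X _ - v) j)]

theorem leadingMatrix_isHermitian {a : Matrix (Fin 3) (Fin 3) ℝ} (ha : ∀ i j, a i j = a j i)
    (r : ℝ) : (leadingMatrix a r).IsHermitian := by
  ext i j
  rw [Matrix.conjTranspose_apply, leadingMatrix_apply, leadingMatrix_apply, ha i j, star_trivial]
  by_cases h : i = j
  · rw [h]
  · rw [if_neg h, if_neg (Ne.symm h)]

theorem mainTheorem1 (M11 M22 M13 M23 M33 : ℝ) :
    let S : Set E3 := quadricSurface (quadricMatrix M11 M22 M13 M23 M33)
    let a : Matrix (Fin 3) (Fin 3) ℝ := covCoeff M11 M22 M13 M23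
    let κ₁ : ℝ := -2 * M11
    let κ₂ : ℝ := -2 * M22
    let κbar : ℝ := (κ₁ + κ₂) / 2
    let e : Fin 3 → E3 := fun i => EuclideanSpace.single i 1
    -- κ₁ and κ₂ are the extreme normal curvatures at the origin, in the directions of the axes
    (∀ θ : ℝ, HasNormalCurvature S θ (κ₁ * Real.cos θ ^ 2 + κ₂ * Real.sin θ ^ 2)) ∧
    IsGreatest {k | ∃ θ, HasNormalCurvature S θ k} (max κ₁ κ₂) ∧
    IsLeast {k | ∃ θ, HasNormalCurvature S θ k} (min κ₁ κ₂) ∧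
    -- the surface has local parametrizations around the origin, and for each of them:
    (∃ U X, IsLocalParametrization S 0 U X) ∧
    ∀ (U : Set (ℝ × ℝ)) (X : ℝ × ℝ → E3), IsLocalParametrization S 0 U X →
      let P : ℝ → Matrix (Fin 3) (Fin 3) ℝ := localDirectionCovariance U X 0
      let L : ℝ → Matrix (Fin 3) (Fin 3) ℝ := leadingCovariance M11 M22 M13 M23
      -- expansion of the matrix
      (∀ i j, (fun r => P r i j - L r i j) =O[𝓝[>] 0] fun r => r ^ 4) ∧
      -- spectrum, both of the matrix itself and of its leading-order approximation
      ∀ Q : ℝ → Matrix (Fin 3) (Fin 3) ℝ, Q = P ∨ Q = L →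
        ∃ ev : Fin 3 → ℝ → ℝ,
          -- eigenvalues, with multiplicity
          (∀ᶠ r in 𝓝[>] 0,
            (Q r).charpoly = ∏ i, (Polynomial.X - Polynomial.C (ev i r))) ∧
          ((fun r => ev 0 r - (1 / 2 - 1 / 32 * (κbar ^ 2 + κ₁ ^ 2) * r ^ 2))
            =O[𝓝[>] 0] fun r => r ^ 4) ∧
          ((fun r => ev 1 r - (1 / 2 - 1 / 32 * (κbar ^ 2 + κ₂ ^ 2) * r ^ 2))
            =O[𝓝[>] 0] fun r => r ^ 4) ∧
          ((fun r => ev 2 r - 1 / 32 * (2 * κbar ^ 2 + κ₁ ^ 2 + κ₂ ^ 2) * r ^ 2)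
            =O[𝓝[>] 0] fun r => r ^ 4) ∧
          -- approximate dominant eigenvectors, normalized in the two-norm
          (∀ i : Fin 3, i ≠ 2 →
            let u : ℝ → E3 := fun r => e i + (2 * a i 2 * r ^ 2) • e 2
            (fun r => ‖Matrix.toEuclideanLin (Q r) (‖u r‖⁻¹ • u r) - ev i r • (‖u r‖⁻¹ • u r)‖)
              =O[𝓝[>] 0] fun r => r ^ 4) ∧
          -- exact dominant eigenvectors lie in the span of the approximate ones up to `O(r⁴)`
          (∃ C : ℝ, ∀ᶠ r in 𝓝[>] 0, ∀ i : Fin 3, i ≠ 2 → ∀ v : E3,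
            Matrix.toEuclideanLin (Q r) v = ev i r • v →
              |v 2 - 2 * r ^ 2 * (a 0 2 * v 0 + a 1 2 * v 1)| ≤ C * r ^ 4 * ‖v‖) ∧
          -- exact dominant eigenvectors one by one, when `κ₁² ≠ κ₂²`
          (κ₁ ^ 2 ≠ κ₂ ^ 2 → ∀ i j : Fin 3, i ≠ 2 → j ≠ 2 → j ≠ i →
            ∃ w : ℝ → E3,
              (∀ᶠ r in 𝓝[>] 0,
                Matrix.toEuclideanLin (Q r) (w r) = ev i r • w r ∧ w r i = 1) ∧
              ((fun r => w r j) =O[𝓝[>] 0] fun r => r ^ 2) ∧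
              ((fun r => w r 2 - 2 * a i 2 * r ^ 2) =O[𝓝[>] 0] fun r => r ^ 4)) := by

  intro S a κ₁ κ₂ κbar e
  let m : QuadricCoeffs := ⟨M11, M22, M13, M23, M33⟩
  have hsym : ∀ i j, a i j = a j i := by
    intro i j; fin_cases i <;> fin_cases j <;> rfl
  refine ⟨fun θ => ?_, m.isGreatest_normalCurvature, m.isLeast_normalCurvature,
    ⟨_, _, m.isLocalParametrization_graph⟩, fun U X hX => ?_⟩
  · exact (QuadricCoeffs.hasNormalCurvature_iff (m := m)).mpr
      (QuadricCoeffs.q_cos_sin_eq (m := m) θ).symm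
  intro P L
  have hP : ∀ i j, (fun r => P r i j - L r i j) =O[𝓝[>] 0] fun r => r ^ 4 :=
    QuadricCoeffs.localDirectionCovariance_expansion (m := m) hX
  refine ⟨hP, fun Q hPL => ?_⟩
  have hQ : ∀ i j, (fun r => Q r i j - leadingMatrix a r i j) =O[𝓝[>] 0] fun r => r ^ 4 := by
    rcases hPL with rfl | rfl
    · exact hP
    · intro i j
      refine (isBigO_zero _ _).congr_left fun r => ?_
      exact (sub_self (L r i j)).symm
  have hQs : ∀ r, (Q r).IsHermitian := by
    rcases hPL with rfl | rfl
    · exact localDirectionCovariance_isHermitian U X 0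
    · exact leadingMatrix_isHermitian hsym
  obtain ⟨ev, hchar, hev⟩ := exists_eigenvalue_expansion hsym rfl hQs hQ
  refine ⟨ev, hchar, ?_, ?_, ?_, fun i hi => ?_, ?_, fun hκ i j hi hj hij => ?_⟩
  · refine (hev 0).congr_left fun r => ?_
    simp [leadingEigenvalue, a, covCoeff, κbar, κ₁, κ₂]; ring
  · refine (hev 1).congr_left fun r => ?_
    simp [leadingEigenvalue, a, covCoeff, κbar, κ₁, κ₂]; ring
  · refine (hev 2).congr_left fun r => ?_
    simp [leadingEigenvalue, a, covCoeff, κbar, κ₁, κ₂]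
    left; ring
  · exact approx_eigenvector_isBigO hsym rfl hQ hev hi rfl
  · obtain ⟨C, -, hC⟩ := dominant_eigenvector_third hsym hQ hev
    refine ⟨C, ?_⟩
    filter_upwards [hC] with r hr i hi v hv
    exact (hr i hi v hv).1
  -- The diagonal entries differ by a₁₁ - a₂₂ = -(κ₁² - κ₂²)/32, so they are distinct exactly when
  -- κ₁² ≠ κ₂².
  · refine exists_normalized_eigenvector hsym rfl hQ hchar hev (fun h => hκ ?_) hi hj hij
    simp [a, covCoeff] at h
    simp only [κ₁, κ₂]
    linear_combination 4 * h
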